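/- Let $k$ be a perfect field. For a coalgebra $C$ (coassociative, counital) over $k$ with comultiplication $\Delta$, a right coideal is a subspace $N\subseteq C$ with $\Delta(N)\subseteq N\otimes C$, and $C$ is called a chain coalgebra if its right coideals are linearly ordered by inclusion. For a coalgebra $C$ and a $C$-bicomodule $M$ with left coaction $\rho^l$ and right coaction $\rho^r$, the cotensor product $M\,\Box_C\,N$ with a left $C$-comodule $(N,\lambda)$ is the kernel of $\rho^r\otimes \mathrm{id}_N-\mathrm{id}_M\otimes\lambda : M\otimes N\to M\otimes C\otimes N$. The cotensor coalgebra is $T_C(M)=\bigoplus_{n\ge 0}M^{\Box n}$, where $M^{\Box 0}=C$, $M^{\Box 1}=M$ and $M^{\Box (n+1)}=M\,\Box_C\, M^{\Box n}$ for $n\geq 1$. Its counit is that of $C$ on $M^{\Box 0}$ and zero on $M^{\Box n}$ for $n>0$. Its comultiplication is $\Delta_C$ on $C$, is $\rho^l+\rho^r$ on $M$, and for $n\ge 2$ is given on $M^{\Box n}$ by $$\Delta(m_1\Box\cdots\Box m_n)=\rho^l(m_1)\Box m_2\Box\cdots\Box m_n+\sum_{i=1}^{n-1}(m_1\Box\cdots\Box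 m_i)\otimes(m_{i+1}\Box\cdots\Box m_n)+m_1\Box\cdots\Box m_{n-1}\Box\rho^r(m_n).$$ For a finite-dimensional division algebra $D$ over $k$ and a $k$-algebra automorphism $\alpha\in\mathrm{Aut}_k(D)$, let $D_\alpha$ be the $D$-bimodule with underlying space $D$ and actions $a\rhd x=ax$, $x\lhd b=x\,\alpha(b)$. Let $D^*$ be the coalgebra dual to the algebra $D$, let $D_\alpha^*$ be the $D^*$-bicomodule dual to $D_\alpha$, and set $\mathcal{DC}(D,\alpha)=T_{D^*}(D_\alpha^*)$. Then for every infinite-dimensional chain coalgebra $C$ over $k$ there exist a finite-dimensional division algebra $D$ over $k$ and $\alpha\in\mathrm{Aut}_k(D)$ such that $C\cong\mathcal{DC}(D,\alpha)$ as coalgebras. -/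

import Mathlib

universe u v

namespace ChainCoalgebra

open scoped TensorProduct
open TensorProduct (assoc map)

section Chain

/-- A right coideal of `C`: a subspace `N` with `Δ(N) ⊆ N ⊗ C`, i.e. a right subcomodule. -/
def IsRightCoideal (k : Type u) {C : Type v} [Field k] [AddCommGroup C] [Module k C]
    [Coalgebra k C] (N : Submodule k C) : Prop :=
  ∀ x ∈ N, Coalgebra.comul (R := k) x ∈ LinearMap.range (N.subtype.rTensor C)

/-- A chain coalgebra: the right coideals are linearly ordered by inclusion. -/
def IsChainCoalgebra (k : Type u) (C : Type v) [Field k] [AddCommGroup C] [Module k C]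
    [Coalgebra k C] : Prop :=
  ∀ N N' : Submodule k C, IsRightCoideal k N → IsRightCoideal k N' → N ≤ N' ∨ N' ≤ N

end Chain

section Comodules

variable {k : Type u} [Field k]

/-- The cotensor product `M □_C N` of a right coaction `ρ` on `M` and a left coaction `l` on `N`:
the elements of `M ⊗ N` on which `ρ ⊗ id` and `id ⊗ l` agree. -/
def cotensor {C M N : Type v} [AddCommGroup C] [Module k C] [AddCommGroup M] [Module k M]
    [AddCommGroup N] [Module k N] (ρ : M →ₗ[k] M ⊗[k] C) (l : N →ₗ[k] C ⊗[k] N) :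
    Submodule k (M ⊗[k] N) :=
  LinearMap.eqLocus ((assoc k M C N).toLinearMap ∘ₗ ρ.rTensor N) (l.lTensor M)

/-- A (coassociative, counital) left `C`-comodule. -/
structure LeftComodule (k : Type u) (C : Type v) [Field k] [AddCommGroup C] [Module k C]
    [Coalgebra k C] where
  carrier : Type v
  [addCommGroup : AddCommGroup carrier]
  [module : Module k carrier]
  coact : carrier →ₗ[k] C ⊗[k] carrier
  coassoc : (assoc k C C carrier).toLinearMap ∘ₗ
    (Coalgebra.comul (R := k) (A := C)).rTensor carrier ∘ₗ coact = coact.lTensor C ∘ₗ coact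
  counit : (Coalgebra.counit (R := k) (A := C)).rTensor carrier ∘ₗ coact =
    TensorProduct.mk k k carrier 1

attribute [instance] LeftComodule.addCommGroup LeftComodule.module

/-- A `C`-bicomodule structure on the vector space `M`. -/
structure Bicomodule (k : Type u) (C M : Type v) [Field k] [AddCommGroup C] [Module k C]
    [Coalgebra k C] [AddCommGroup M] [Module k M] where
  left : M →ₗ[k] C ⊗[k] M
  right : M →ₗ[k] M ⊗[k] C
  left_coassoc : (assoc k C C M).toLinearMap ∘ₗ
    (Coalgebra.comul (R := k) (A := C)).rTensor M ∘ₗ left = left.lTensor C ∘ₗ left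
  left_counit : (Coalgebra.counit (R := k) (A := C)).rTensor M ∘ₗ left = TensorProduct.mk k k M 1
  right_coassoc : (assoc k M C C).toLinearMap ∘ₗ right.rTensor C ∘ₗ right =
    (Coalgebra.comul (R := k) (A := C)).lTensor M ∘ₗ right
  right_counit : (Coalgebra.counit (R := k) (A := C)).lTensor M ∘ₗ right =
    (TensorProduct.mk k M k).flip 1
  left_right : (assoc k C M C).toLinearMap ∘ₗ left.rTensor C ∘ₗ right = right.lTensor C ∘ₗ left

section Flat

variable {A B X Q : Type v} [AddCommGroup A] [Module k A] [AddCommGroup B] [Module k B]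
  [AddCommGroup X] [Module k X] [AddCommGroup Q] [Module k Q]

theorem lTensor_inj {Q : Type*} [AddCommGroup Q] [Module k Q] {f : A →ₗ[k] B}
    (hf : Function.Injective f) : Function.Injective (f.lTensor Q) :=
  Module.Flat.lTensor_preserves_injective_linearMap f hf

theorem rTensor_inj {Q : Type*} [AddCommGroup Q] [Module k Q] {f : A →ₗ[k] B}
    (hf : Function.Injective f) : Function.Injective (f.rTensor Q) :=
  Module.Flat.rTensor_preserves_injective_linearMap f hf

theorem mem_range_lTensor_eqLocus (f g : A →ₗ[k] B) (x : Q ⊗[k] A)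
    (h : f.lTensor Q x = g.lTensor Q x) :
    x ∈ LinearMap.range ((LinearMap.eqLocus f g).subtype.lTensor Q) := by
  have := Module.Flat.eqLocus_lTensor_eq (R := k) k Q f g
  have hx : x ∈ LinearMap.eqLocus (TensorProduct.AlgebraTensorModule.lTensor k Q f)
    (TensorProduct.AlgebraTensorModule.lTensor k Q g) := h
  rw [this] at hx
  exact hx

theorem mem_range_rTensor_eqLocus (f g : A →ₗ[k] B) (x : A ⊗[k] Q)
    (h : f.rTensor Q x = g.rTensor Q x) :
    x ∈ LinearMap.range ((LinearMap.eqLocus f g).subtype.rTensor Q) := by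
  have := mem_range_lTensor_eqLocus (Q := Q) f g (TensorProduct.comm k A Q x) (by
    rw [← LinearMap.comm_comp_rTensor_comp_comm_eq, ← LinearMap.comm_comp_rTensor_comp_comm_eq] 
    simp [h])
  obtain ⟨y, hy⟩ := this
  refine ⟨TensorProduct.comm k _ _ y, (TensorProduct.comm k A Q).injective ?_⟩
  rw [← hy, ← LinearMap.comm_comp_rTensor_comp_comm_eq]
  simp

end Flat

section CotensorMaps

variable {C M N N' Q : Type v} [AddCommGroup C] [Module k C]
  [AddCommGroup M] [Module k M] [AddCommGroup N] [Module k N] [AddCommGroup N'] [Module k N']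
  [AddCommGroup Q] [Module k Q]

theorem cotensorMap_aux (ρ : M →ₗ[k] M ⊗[k] C) (l : N →ₗ[k] C ⊗[k] N)
    (l' : N' →ₗ[k] C ⊗[k] N') (f : N →ₗ[k] N' ⊗[k] Q)
    (hf : (assoc k C N' Q).toLinearMap ∘ₗ l'.rTensor Q ∘ₗ f = f.lTensor C ∘ₗ l)
    (x : cotensor ρ l) :
    (assoc k M N' Q).symm (f.lTensor M x) ∈
      LinearMap.range ((cotensor ρ l').subtype.rTensor Q) := by
  obtain ⟨x, hx⟩ := x
  apply mem_range_rTensor_eqLocus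
  apply (assoc k M (C ⊗[k] N') Q).injective
  apply (LinearEquiv.lTensor M (assoc k C N' Q)).injective
  have h1 : ∀ y : M ⊗[k] N, (LinearEquiv.lTensor M (assoc k C N' Q))
      (assoc k M (C ⊗[k] N') Q
        ((((assoc k M C N').toLinearMap ∘ₗ ρ.rTensor N').rTensor Q)
          ((assoc k M N' Q).symm (f.lTensor M y)))) =
      (f.lTensor C).lTensor M (assoc k M C N (ρ.rTensor N y)) := by
    intro y
    induction y with
    | zero => simp
    | add a b ha hb => simp only [map_add, ha, hb]
    | tmul m n =>
      simp only [LinearMap.lTensor_tmul, LinearMap.rTensor_tmul]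
      have e1 : ∀ z : N' ⊗[k] Q, (LinearEquiv.lTensor M (assoc k C N' Q))
          (assoc k M (C ⊗[k] N') Q
            ((((assoc k M C N').toLinearMap ∘ₗ ρ.rTensor N').rTensor Q)
              ((assoc k M N' Q).symm (m ⊗ₜ z)))) = assoc k M C (N' ⊗[k] Q) (ρ m ⊗ₜ z) := by
        intro z
        induction z with
        | zero => simp
        | add a b ha hb => simp only [map_add, TensorProduct.tmul_add, ha, hb]
        | tmul a b =>
          simp only [TensorProduct.assoc_symm_tmul, LinearMap.rTensor_tmul, LinearMap.comp_apply]
          generalize ρ m = w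
          induction w with
          | zero => simp
          | add a b ha hb => simp only [map_add, TensorProduct.add_tmul, ha, hb]
          | tmul c d => simp
      rw [e1]
      generalize ρ m = w
      induction w with
      | zero => simp
      | add a b ha hb => simp only [map_add, TensorProduct.add_tmul, ha, hb]
      | tmul c d => simp
  have h2 : ∀ y : M ⊗[k] N, (LinearEquiv.lTensor M (assoc k C N' Q))
      (assoc k M (C ⊗[k] N') Q
        (((l'.lTensor M).rTensor Q) ((assoc k M N' Q).symm (f.lTensor M y)))) =
      ((assoc k C N' Q).toLinearMap ∘ₗ l'.rTensor Q ∘ₗ f).lTensor M y := by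
    intro y
    induction y with
    | zero => simp
    | add a b ha hb => simp only [map_add, ha, hb]
    | tmul m n =>
      simp only [LinearMap.lTensor_tmul, LinearMap.comp_apply]
      generalize f n = z
      induction z with
      | zero => simp
      | add a b ha hb => simp only [map_add, TensorProduct.tmul_add, ha, hb]
      | tmul a b => simp
  rw [h1, h2, hf]
  have hx' : (assoc k M C N) (ρ.rTensor N x) = l.lTensor M x := hx
  rw [hx', ← LinearMap.comp_apply, ← LinearMap.lTensor_comp]


/-- `id_M □ f : M □ N → (M □ N') ⊗ Q` for a left colinear map `f : N → N' ⊗ Q`. -/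
noncomputable def cotensorMap (ρ : M →ₗ[k] M ⊗[k] C) (l : N →ₗ[k] C ⊗[k] N)
    (l' : N' →ₗ[k] C ⊗[k] N') (f : N →ₗ[k] N' ⊗[k] Q)
    (hf : (assoc k C N' Q).toLinearMap ∘ₗ l'.rTensor Q ∘ₗ f = f.lTensor C ∘ₗ l) :
    cotensor ρ l →ₗ[k] cotensor ρ l' ⊗[k] Q :=
  LinearMap.codRestrictOfInjective
    ((assoc k M N' Q).symm.toLinearMap ∘ₗ f.lTensor M ∘ₗ (cotensor ρ l).subtype)
    ((cotensor ρ l').subtype.rTensor Q)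
    (rTensor_inj (Submodule.subtype_injective _)) (cotensorMap_aux ρ l l' f hf)

theorem subtype_cotensorMap (ρ : M →ₗ[k] M ⊗[k] C) (l : N →ₗ[k] C ⊗[k] N)
    (l' : N' →ₗ[k] C ⊗[k] N') (f : N →ₗ[k] N' ⊗[k] Q)
    (hf : (assoc k C N' Q).toLinearMap ∘ₗ l'.rTensor Q ∘ₗ f = f.lTensor C ∘ₗ l)
    (x : cotensor ρ l) :
    (cotensor ρ l').subtype.rTensor Q (cotensorMap ρ l l' f hf x) =
      (assoc k M N' Q).symm (f.lTensor M x) :=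
  LinearMap.codRestrictOfInjective_comp_apply _ _ _ _ x

variable [Coalgebra k C]

theorem cotensorCoact_aux (B : Bicomodule k C M) (l : N →ₗ[k] C ⊗[k] N)
    (x : cotensor B.right l) :
    assoc k C M N (B.left.rTensor N x) ∈
      LinearMap.range ((cotensor B.right l).subtype.lTensor C) := by
  obtain ⟨x, hx⟩ := x
  apply mem_range_lTensor_eqLocus
  have h1 : ∀ y : M ⊗[k] N, (((assoc k M C N).toLinearMap ∘ₗ B.right.rTensor N).lTensor C)
      (assoc k C M N (B.left.rTensor N y)) =
      (assoc k M C N).toLinearMap.lTensor C (assoc k C (M ⊗[k] C) N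
        ((B.right.lTensor C ∘ₗ B.left).rTensor N y)) := by
    intro y
    induction y with
    | zero => simp
    | add a b ha hb => simp only [map_add, ha, hb]
    | tmul m n =>
      simp only [LinearMap.rTensor_tmul, LinearMap.comp_apply]
      generalize B.left m = w
      induction w with
      | zero => simp
      | add a b ha hb => simp only [map_add, TensorProduct.add_tmul, ha, hb]
      | tmul c d => simp
  have h2 : ∀ y : M ⊗[k] N, (assoc k M C N).toLinearMap.lTensor C (assoc k C (M ⊗[k] C) N
        (((assoc k C M C).toLinearMap ∘ₗ B.left.rTensor C ∘ₗ B.right).rTensor N y)) =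
      assoc k C M (C ⊗[k] N) (B.left.rTensor (C ⊗[k] N) (assoc k M C N (B.right.rTensor N y))) := by
    intro y
    induction y with
    | zero => simp
    | add a b ha hb => simp only [map_add, ha, hb]
    | tmul m n =>
      simp only [LinearMap.rTensor_tmul, LinearMap.comp_apply]
      generalize B.right m = w
      induction w with
      | zero => simp
      | add a b ha hb => simp only [map_add, TensorProduct.add_tmul, ha, hb]
      | tmul c d =>
        simp only [LinearMap.rTensor_tmul, LinearEquiv.coe_coe, TensorProduct.assoc_tmul]
        generalize B.left c = w
        induction w with
        | zero => simp
        | add a b ha hb => simp only [map_add, TensorProduct.add_tmul, ha, hb]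
        | tmul c d => simp
  have h3 : ∀ y : M ⊗[k] N, assoc k C M (C ⊗[k] N) (B.left.rTensor (C ⊗[k] N) (l.lTensor M y)) =
      (l.lTensor M).lTensor C (assoc k C M N (B.left.rTensor N y)) := by
    intro y
    induction y with
    | zero => simp
    | add a b ha hb => simp only [map_add, ha, hb]
    | tmul m n =>
      simp only [LinearMap.rTensor_tmul, LinearMap.lTensor_tmul]
      generalize B.left m = w
      induction w with
      | zero => simp
      | add a b ha hb => simp only [map_add, TensorProduct.add_tmul, ha, hb]
      | tmul c d => simp
  have hx' : (assoc k M C N) (B.right.rTensor N x) = l.lTensor M x := hx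
  rw [← h3, ← hx', h1, ← B.left_right, h2]

/-- The left coaction of `C` on `M □ N` induced by the left coaction on `M`. -/
noncomputable def cotensorCoact (B : Bicomodule k C M) (l : N →ₗ[k] C ⊗[k] N) :
    cotensor B.right l →ₗ[k] C ⊗[k] cotensor B.right l :=
  LinearMap.codRestrictOfInjective
    ((assoc k C M N).toLinearMap ∘ₗ B.left.rTensor N ∘ₗ (cotensor B.right l).subtype)
    ((cotensor B.right l).subtype.lTensor C)
    (lTensor_inj (Submodule.subtype_injective _)) (cotensorCoact_aux B l)

theorem subtype_cotensorCoact (B : Bicomodule k C M) (l : N →ₗ[k] C ⊗[k] N)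
    (x : cotensor B.right l) :
    (cotensor B.right l).subtype.lTensor C (cotensorCoact B l x) =
      assoc k C M N (B.left.rTensor N x) :=
  LinearMap.codRestrictOfInjective_comp_apply _ _ _ _ x

theorem cotensorCoact_coassoc (B : Bicomodule k C M) (l : N →ₗ[k] C ⊗[k] N) :
    (assoc k C C (cotensor B.right l)).toLinearMap ∘ₗ
      (Coalgebra.comul (R := k) (A := C)).rTensor (cotensor B.right l) ∘ₗ cotensorCoact B l =
    (cotensorCoact B l).lTensor C ∘ₗ cotensorCoact B l := by
  ext x
  apply lTensor_inj (Q := C) (lTensor_inj (Q := C) (Submodule.subtype_injective _))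
  have h1 : ∀ y : C ⊗[k] cotensor B.right l,
      ((cotensor B.right l).subtype.lTensor C).lTensor C
        (assoc k C C (cotensor B.right l)
          ((Coalgebra.comul (R := k) (A := C)).rTensor (cotensor B.right l) y)) =
      assoc k C C (M ⊗[k] N) ((Coalgebra.comul (R := k) (A := C)).rTensor (M ⊗[k] N)
        ((cotensor B.right l).subtype.lTensor C y)) := by
    intro y
    induction y with
    | zero => simp
    | add a b ha hb => simp only [map_add, ha, hb]
    | tmul m n =>
      simp only [LinearMap.rTensor_tmul, LinearMap.lTensor_tmul]
      generalize Coalgebra.comul (R := k) (A := C) m = w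
      induction w with
      | zero => simp
      | add a b ha hb => simp only [map_add, TensorProduct.add_tmul, ha, hb]
      | tmul c d => simp
  have h2 : ∀ y : C ⊗[k] cotensor B.right l,
      ((cotensor B.right l).subtype.lTensor C).lTensor C ((cotensorCoact B l).lTensor C y) =
      ((assoc k C M N).toLinearMap ∘ₗ B.left.rTensor N).lTensor C
        ((cotensor B.right l).subtype.lTensor C y) := by
    intro y
    induction y with
    | zero => simp
    | add a b ha hb => simp only [map_add, ha, hb]
    | tmul m n =>
      simp only [LinearMap.lTensor_tmul, subtype_cotensorCoact]
      rfl
  have h3 : ∀ y : M ⊗[k] N, assoc k C C (M ⊗[k] N)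
      ((Coalgebra.comul (R := k) (A := C)).rTensor (M ⊗[k] N)
        (assoc k C M N (B.left.rTensor N y))) =
      (assoc k C M N).toLinearMap.lTensor C (assoc k C (C ⊗[k] M) N
        (((assoc k C C M).toLinearMap ∘ₗ (Coalgebra.comul (R := k) (A := C)).rTensor M ∘ₗ
          B.left).rTensor N y)) := by
    intro y
    induction y with
    | zero => simp
    | add a b ha hb => simp only [map_add, ha, hb]
    | tmul m n =>
      simp only [LinearMap.rTensor_tmul, LinearMap.comp_apply]
      generalize B.left m = w
      induction w with
      | zero => simp
      | add a b ha hb => simp only [map_add, TensorProduct.add_tmul, ha, hb]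
      | tmul c d =>
        simp only [LinearMap.rTensor_tmul, LinearEquiv.coe_coe, TensorProduct.assoc_tmul]
        generalize Coalgebra.comul (R := k) (A := C) c = w
        induction w with
        | zero => simp
        | add a b ha hb => simp only [map_add, TensorProduct.add_tmul, ha, hb]
        | tmul c d => simp
  have h4 : ∀ y : M ⊗[k] N, ((assoc k C M N).toLinearMap ∘ₗ B.left.rTensor N).lTensor C
        (assoc k C M N (B.left.rTensor N y)) =
      (assoc k C M N).toLinearMap.lTensor C (assoc k C (C ⊗[k] M) N
        ((B.left.lTensor C ∘ₗ B.left).rTensor N y)) := by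
    intro y
    induction y with
    | zero => simp
    | add a b ha hb => simp only [map_add, ha, hb]
    | tmul m n =>
      simp only [LinearMap.rTensor_tmul, LinearMap.comp_apply]
      generalize B.left m = w
      induction w with
      | zero => simp
      | add a b ha hb => simp only [map_add, TensorProduct.add_tmul, ha, hb]
      | tmul c d => simp
  simp only [LinearMap.comp_apply, LinearEquiv.coe_coe]
  rw [h1, h2, subtype_cotensorCoact, h3, h4, B.left_coassoc]

theorem cotensorCoact_counit (B : Bicomodule k C M) (l : N →ₗ[k] C ⊗[k] N) :
    (Coalgebra.counit (R := k) (A := C)).rTensor (cotensor B.right l) ∘ₗ cotensorCoact B l =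
    TensorProduct.mk k k (cotensor B.right l) 1 := by
  ext x
  apply lTensor_inj (Q := k) (Submodule.subtype_injective (cotensor B.right l))
  have h1 : ∀ y : C ⊗[k] cotensor B.right l,
      (cotensor B.right l).subtype.lTensor k
          ((Coalgebra.counit (R := k) (A := C)).rTensor (cotensor B.right l) y) =
      (Coalgebra.counit (R := k) (A := C)).rTensor (M ⊗[k] N)
        ((cotensor B.right l).subtype.lTensor C y) := by
    intro y
    rw [← LinearMap.comp_apply, ← LinearMap.comp_apply, LinearMap.lTensor_comp_rTensor,
      LinearMap.rTensor_comp_lTensor]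
  have h3 : ∀ y : M ⊗[k] N, (Coalgebra.counit (R := k) (A := C)).rTensor (M ⊗[k] N)
        (assoc k C M N (B.left.rTensor N y)) =
      assoc k k M N
        (((Coalgebra.counit (R := k) (A := C)).rTensor M ∘ₗ B.left).rTensor N y) := by
    intro y
    induction y with
    | zero => simp
    | add a b ha hb => simp only [map_add, ha, hb]
    | tmul m n =>
      simp only [LinearMap.rTensor_tmul, LinearMap.comp_apply]
      generalize B.left m = w
      induction w with
      | zero => simp
      | add a b ha hb => simp only [map_add, TensorProduct.add_tmul, ha, hb]
      | tmul c d => simp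
  have h4 : ∀ y : M ⊗[k] N, assoc k k M N ((TensorProduct.mk k k M 1).rTensor N y) =
      (1 : k) ⊗ₜ[k] y := by
    intro y
    induction y with
    | zero => simp
    | add a b ha hb => simp only [map_add, TensorProduct.tmul_add, ha, hb]
    | tmul m n => simp
  simp only [LinearMap.comp_apply]
  rw [h1, subtype_cotensorCoact, h3, B.left_counit, h4]
  simp

/-- `id_M □ f` is again left colinear. -/
theorem cotensorMap_colinear (B : Bicomodule k C M) (l : N →ₗ[k] C ⊗[k] N)
    (l' : N' →ₗ[k] C ⊗[k] N') (f : N →ₗ[k] N' ⊗[k] Q)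
    (hf : (assoc k C N' Q).toLinearMap ∘ₗ l'.rTensor Q ∘ₗ f = f.lTensor C ∘ₗ l) :
    (assoc k C (cotensor B.right l') Q).toLinearMap ∘ₗ (cotensorCoact B l').rTensor Q ∘ₗ
      cotensorMap B.right l l' f hf =
    (cotensorMap B.right l l' f hf).lTensor C ∘ₗ cotensorCoact B l := by
  ext x
  apply lTensor_inj (Q := C) (rTensor_inj (Q := Q) (Submodule.subtype_injective _))
  have h1 : ∀ y : cotensor B.right l' ⊗[k] Q,
      ((cotensor B.right l').subtype.rTensor Q).lTensor C
        (assoc k C (cotensor B.right l') Q ((cotensorCoact B l').rTensor Q y)) =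
      assoc k C (M ⊗[k] N') Q (((assoc k C M N').toLinearMap ∘ₗ B.left.rTensor N').rTensor Q
        ((cotensor B.right l').subtype.rTensor Q y)) := by
    intro y
    induction y with
    | zero => simp
    | add a b ha hb => simp only [map_add, ha, hb]
    | tmul m n =>
      simp only [LinearMap.rTensor_tmul, LinearMap.comp_apply, Submodule.subtype_apply,
        LinearEquiv.coe_coe]
      rw [← subtype_cotensorCoact B l' m]
      generalize cotensorCoact B l' m = w
      induction w with
      | zero => simp
      | add a b ha hb => simp only [map_add, TensorProduct.add_tmul, ha, hb]
      | tmul c d => simp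
  have h2 : ∀ y : C ⊗[k] cotensor B.right l,
      ((cotensor B.right l').subtype.rTensor Q).lTensor C
        ((cotensorMap B.right l l' f hf).lTensor C y) =
      ((assoc k M N' Q).symm.toLinearMap ∘ₗ f.lTensor M).lTensor C
        ((cotensor B.right l).subtype.lTensor C y) := by
    intro y
    induction y with
    | zero => simp
    | add a b ha hb => simp only [map_add, ha, hb]
    | tmul m n =>
      simp only [LinearMap.lTensor_tmul, subtype_cotensorMap]
      rfl
  have h3 : ∀ y : M ⊗[k] N,
      assoc k C (M ⊗[k] N') Q (((assoc k C M N').toLinearMap ∘ₗ B.left.rTensor N').rTensor Q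
        ((assoc k M N' Q).symm (f.lTensor M y))) =
      ((assoc k M N' Q).symm.toLinearMap ∘ₗ f.lTensor M).lTensor C
        (assoc k C M N (B.left.rTensor N y)) := by
    intro y
    induction y with
    | zero => simp
    | add a b ha hb => simp only [map_add, ha, hb]
    | tmul m n =>
      have e1 : ∀ z : N' ⊗[k] Q,
          assoc k C (M ⊗[k] N') Q (((assoc k C M N').toLinearMap ∘ₗ B.left.rTensor N').rTensor Q
            ((assoc k M N' Q).symm (m ⊗ₜ z))) =
          (assoc k M N' Q).symm.toLinearMap.lTensor C (assoc k C M (N' ⊗[k] Q)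
            (B.left m ⊗ₜ z)) := by
        intro z
        induction z with
        | zero => simp
        | add a b ha hb => simp only [map_add, TensorProduct.tmul_add, ha, hb]
        | tmul a b =>
          simp only [TensorProduct.assoc_symm_tmul, LinearMap.rTensor_tmul, LinearMap.comp_apply]
          generalize B.left m = w
          induction w with
          | zero => simp
          | add a b ha hb => simp only [map_add, TensorProduct.add_tmul, ha, hb]
          | tmul c d => simp
      simp only [LinearMap.rTensor_tmul, LinearMap.lTensor_tmul, e1]
      generalize B.left m = w
      induction w with
      | zero => simp
      | add a b ha hb => simp only [map_add, TensorProduct.add_tmul, ha, hb]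
      | tmul c d => simp
  simp only [LinearMap.comp_apply, LinearEquiv.coe_coe]
  rw [h1, h2, subtype_cotensorCoact, subtype_cotensorMap, h3]

end CotensorMaps

section Steps

variable {M A A' X X' J L R : Type v} [AddCommGroup M] [Module k M] [AddCommGroup A] [Module k A]
  [AddCommGroup A'] [Module k A'] [AddCommGroup X] [Module k X] [AddCommGroup X'] [Module k X']
  [AddCommGroup J] [Module k J] [AddCommGroup L] [Module k L] [AddCommGroup R] [Module k R]

theorem coassoc_step_left (S : A →ₗ[k] M ⊗[k] X) (T : A' →ₗ[k] M ⊗[k] X') (F : A →ₗ[k] A' ⊗[k] J)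
    (f : X →ₗ[k] X' ⊗[k] J)
    (h : ∀ a, T.rTensor J (F a) = (assoc k M X' J).symm (f.lTensor M (S a))) (u : A ⊗[k] L) :
    assoc k M X' (J ⊗[k] L) (T.rTensor (J ⊗[k] L) (assoc k A' J L (F.rTensor L u))) =
      ((assoc k X' J L).toLinearMap ∘ₗ f.rTensor L).lTensor M (assoc k M X L (S.rTensor L u)) := by
  induction u with
  | zero => simp
  | add a b ha hb => simp only [map_add, ha, hb]
  | tmul a b =>
    have e1 : ∀ w : A' ⊗[k] J,
        assoc k M X' (J ⊗[k] L) (T.rTensor (J ⊗[k] L) (assoc k A' J L (w ⊗ₜ b))) =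
        (assoc k X' J L).toLinearMap.lTensor M (assoc k M (X' ⊗[k] J) L
          ((assoc k M X' J (T.rTensor J w)) ⊗ₜ b)) := by
      intro w
      induction w with
      | zero => simp
      | add a b ha hb => simp only [map_add, TensorProduct.add_tmul, ha, hb]
      | tmul c d =>
        simp only [LinearMap.rTensor_tmul, TensorProduct.assoc_tmul]
        generalize T c = z
        induction z with
        | zero => simp
        | add a b ha hb => simp only [map_add, TensorProduct.add_tmul, ha, hb]
        | tmul c d => simp
    simp only [LinearMap.rTensor_tmul]
    rw [e1, h, LinearEquiv.apply_symm_apply]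
    generalize S a = z
    induction z with
    | zero => simp
    | add a b ha hb => simp only [map_add, TensorProduct.add_tmul, ha, hb]
    | tmul c d => simp

theorem coassoc_step_right (T : A' →ₗ[k] M ⊗[k] X') (g : R →ₗ[k] J ⊗[k] L) (w : A' ⊗[k] R) :
    assoc k M X' (J ⊗[k] L) (T.rTensor (J ⊗[k] L) (g.lTensor A' w)) =
      (g.lTensor X').lTensor M (assoc k M X' R (T.rTensor R w)) := by
  induction w with
  | zero => simp
  | add a b ha hb => simp only [map_add, ha, hb]
  | tmul a b =>
    simp only [LinearMap.rTensor_tmul, LinearMap.lTensor_tmul]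
    generalize T a = z
    induction z with
    | zero => simp
    | add a b ha hb => simp only [map_add, TensorProduct.add_tmul, ha, hb]
    | tmul c d => simp

end Steps

section Powers

variable {C M : Type v} [AddCommGroup C] [Module k C] [Coalgebra k C]
  [AddCommGroup M] [Module k M]

/-- The left comodule `M □_C N` of a bicomodule `M` and a left comodule `N`. -/
noncomputable def Bicomodule.cotensor (B : Bicomodule k C M) (N : LeftComodule k C) :
    LeftComodule k C where
  carrier := ChainCoalgebra.cotensor B.right N.coact
  coact := cotensorCoact B N.coact
  coassoc := cotensorCoact_coassoc B N.coact
  counit := cotensorCoact_counit B N.coact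

/-- The cotensor powers `M^{□ n}`, with their left coactions: `M^{□ 0} = C`, `M^{□ 1} = M` and
`M^{□ (n + 2)} = M □ M^{□ (n + 1)}`. -/
noncomputable def Bicomodule.power (B : Bicomodule k C M) : ℕ → LeftComodule k C
  | 0 => ⟨C, Coalgebra.comul, Coalgebra.coassoc, Coalgebra.rTensor_counit_comp_comul⟩
  | 1 => ⟨M, B.left, B.left_coassoc, B.left_counit⟩
  | n + 2 => B.cotensor (B.power (n + 1))

/-- The component `M^{□ (i + j)} → M^{□ i} ⊗ M^{□ j}` of the comultiplication, together with the
fact that it is left colinear. It is the left coaction for `i = 0`, the right coaction for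
`(i, j) = (1, 0)`, the inclusion for `i = 1` and `j > 0`, and `id_M □ Δ_{i - 1, j}` for `i > 1`. -/
noncomputable def Bicomodule.split (B : Bicomodule k C M) : (i j : ℕ) →
    {f : (B.power (j + i)).carrier →ₗ[k] (B.power i).carrier ⊗[k] (B.power j).carrier //
      (assoc k C (B.power i).carrier (B.power j).carrier).toLinearMap ∘ₗ
        (B.power i).coact.rTensor (B.power j).carrier ∘ₗ f =
      f.lTensor C ∘ₗ (B.power (j + i)).coact}
  | 0, j => ⟨(B.power j).coact, (B.power j).coassoc⟩
  | 1, 0 => ⟨B.right, B.left_right⟩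
  | 1, j + 1 => ⟨(ChainCoalgebra.cotensor B.right (B.power (j + 1)).coact).subtype, by
      ext x; exact (subtype_cotensorCoact B (B.power (j + 1)).coact x).symm⟩
  | i + 2, j =>
      ⟨cotensorMap B.right (B.power (j + (i + 1))).coact (B.power (i + 1)).coact
        (B.split (i + 1) j).1 (B.split (i + 1) j).2,
       cotensorMap_colinear B (B.power (j + (i + 1))).coact (B.power (i + 1)).coact
        (B.split (i + 1) j).1 (B.split (i + 1) j).2⟩


/-- The component `M^{□ n} → M^{□ i} ⊗ M^{□ j}` of the comultiplication (zero unless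
`n = i + j`). -/
noncomputable def Bicomodule.part (B : Bicomodule k C M) (i j n : ℕ) :
    (B.power n).carrier →ₗ[k] (B.power i).carrier ⊗[k] (B.power j).carrier :=
  (B.split i j).1 ∘ₗ DirectSum.component k ℕ (fun m => (B.power m).carrier) (j + i) ∘ₗ
    DirectSum.lof k ℕ (fun m => (B.power m).carrier) n

theorem Bicomodule.part_self (B : Bicomodule k C M) (i j : ℕ) :
    B.part i j (j + i) = (B.split i j).1 := by
  ext x
  simp only [Bicomodule.part, LinearMap.comp_apply, DirectSum.component.lof_self]

theorem Bicomodule.part_succ (B : Bicomodule k C M) (i j n : ℕ) (h : j + i = n)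
    (x : (B.power (n + 2)).carrier) :
    (ChainCoalgebra.cotensor B.right (B.power (i + 1)).coact).subtype.rTensor
        (B.power j).carrier (B.part (i + 2) j (n + 2) x) =
      (assoc k M (B.power (i + 1)).carrier (B.power j).carrier).symm
        ((B.part (i + 1) j (n + 1)).lTensor M
          ((ChainCoalgebra.cotensor B.right (B.power (n + 1)).coact).subtype x)) := by
  subst h
  have h1 : B.part (i + 2) j (j + i + 2) = (B.split (i + 2) j).1 := B.part_self (i + 2) j
  have h2 : B.part (i + 1) j (j + i + 1) = (B.split (i + 1) j).1 := B.part_self (i + 1) j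
  rw [h1, h2]
  exact subtype_cotensorMap B.right (B.power (j + (i + 1))).coact (B.power (i + 1)).coact
        (B.split (i + 1) j).1 (B.split (i + 1) j).2 x

theorem Bicomodule.part_coassoc (B : Bicomodule k C M) (i j l m r n : ℕ) (h1 : j + i = m)
    (h2 : l + m = n) (h3 : l + j = r) (h4 : r + i = n) :
    (assoc k (B.power i).carrier (B.power j).carrier (B.power l).carrier).toLinearMap ∘ₗ
      (B.part i j m).rTensor (B.power l).carrier ∘ₗ B.part m l n =
    (B.part j l r).lTensor (B.power i).carrier ∘ₗ B.part i r n := by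
  induction i generalizing m r n with
  | zero =>
    obtain rfl : j = m := h1
    obtain rfl : r = n := h4
    subst h3
    have e1 : B.part 0 j j = (B.power j).coact := B.part_self 0 j
    have e2 : B.part 0 (l + j) (l + j) = (B.power (l + j)).coact := B.part_self 0 (l + j)
    rw [e1, e2, B.part_self]
    exact (B.split j l).2
  | succ i ih =>
    cases i with
    | zero =>
      cases j with
      | zero =>
        obtain rfl : 1 = m := by omega
        obtain rfl : l = r := by omega
        subst h2
        have e1 : B.part 1 0 1 = B.right := B.part_self 1 0
        have e2 : B.part 0 l l = (B.power l).coact := B.part_self 0 l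
        rw [e1, e2]
        cases l with
        | zero =>
          have e3 : B.part 1 0 (0 + 1) = B.right := B.part_self 1 0
          rw [e3]
          exact B.right_coassoc
        | succ l =>
          have e3 : B.part 1 (l + 1) (l + 1 + 1) =
            (ChainCoalgebra.cotensor B.right (B.power (l + 1)).coact).subtype :=
            B.part_self 1 (l + 1)
          rw [e3]
          ext x
          exact x.2
      | succ j =>
        obtain rfl : j + 2 = m := by omega
        subst h3
        obtain rfl : l + j + 2 = n := by omega
        have e1 : B.part 1 (j + 1) (j + 2) =
            (ChainCoalgebra.cotensor B.right (B.power (j + 1)).coact).subtype :=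
          B.part_self 1 (j + 1)
        have e2 : B.part 1 (l + (j + 1)) (l + j + 2) =
            (ChainCoalgebra.cotensor B.right (B.power (l + j + 1)).coact).subtype :=
          B.part_self 1 (l + j + 1)
        ext x
        have := B.part_succ j l (l + j) rfl x
        rw [LinearEquiv.eq_symm_apply] at this
        simp only [e1, e2]
        exact this
    | succ i =>
      obtain ⟨m, rfl⟩ : ∃ m', m = m' + 2 := ⟨m - 2, by omega⟩
      obtain ⟨n, rfl⟩ : ∃ n', n = n' + 2 := ⟨n - 2, by omega⟩
      have ih' := ih (m + 1) r (n + 1) (by omega) (by omega) h3 (by omega)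
      ext x
      apply rTensor_inj (Q := (B.power j).carrier ⊗[k] (B.power l).carrier)
        (Submodule.subtype_injective
          (ChainCoalgebra.cotensor B.right (B.power (i + 1)).coact))
      apply (assoc k M (B.power (i + 1)).carrier
        ((B.power j).carrier ⊗[k] (B.power l).carrier)).injective
      have e1 := coassoc_step_left (L := (B.power l).carrier)
        (ChainCoalgebra.cotensor B.right (B.power (m + 1)).coact).subtype
        (ChainCoalgebra.cotensor B.right (B.power (i + 1)).coact).subtype
        (B.part (i + 2) j (m + 2)) (B.part (i + 1) j (m + 1))
        (fun a => B.part_succ i j m (by omega) a) (B.part (m + 2) l (n + 2) x)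
      have e2 := coassoc_step_right
        (ChainCoalgebra.cotensor B.right (B.power (i + 1)).coact).subtype (B.part j l r)
        (B.part (i + 2) r (n + 2) x)
      refine e1.trans (Eq.trans ?_ e2.symm)
      rw [B.part_succ m l n (by omega), B.part_succ i r n (by omega),
        LinearEquiv.apply_symm_apply, LinearEquiv.apply_symm_apply,
        ← LinearMap.comp_apply, ← LinearMap.lTensor_comp, LinearMap.comp_assoc, ih',
        LinearMap.lTensor_comp, LinearMap.comp_apply]

/-- The counit of `C`, on `M^{□ 0} = C`. -/
noncomputable def Bicomodule.counitZero (B : Bicomodule k C M) : (B.power 0).carrier →ₗ[k] k :=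
  Coalgebra.counit (R := k) (A := C)

theorem Bicomodule.part_counit_left (B : Bicomodule k C M) (n : ℕ) :
    B.counitZero.rTensor (B.power n).carrier ∘ₗ B.part 0 n n =
      TensorProduct.mk k k (B.power n).carrier 1 := by
  have e1 : B.part 0 n n = (B.power n).coact := B.part_self 0 n
  rw [e1]
  exact (B.power n).counit

theorem Bicomodule.part_counit_right (B : Bicomodule k C M) (n : ℕ) :
    B.counitZero.lTensor (B.power n).carrier ∘ₗ B.part n 0 n =
      (TensorProduct.mk k (B.power n).carrier k).flip 1 := by
  induction n with
  | zero =>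
    have e1 : B.part 0 0 0 = Coalgebra.comul (R := k) (A := C) := B.part_self 0 0
    rw [e1]
    exact Coalgebra.lTensor_counit_comp_comul (R := k) (A := C)
  | succ n ih =>
    cases n with
    | zero =>
      have e1 : B.part 1 0 1 = B.right := B.part_self 1 0
      rw [e1]
      exact B.right_counit
    | succ n =>
      ext x
      apply rTensor_inj (Q := k) (Submodule.subtype_injective
          (ChainCoalgebra.cotensor B.right (B.power (n + 1)).coact))
      have h1 : ∀ y : ChainCoalgebra.cotensor B.right (B.power (n + 1)).coact ⊗[k]
            (B.power 0).carrier,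
          (ChainCoalgebra.cotensor B.right (B.power (n + 1)).coact).subtype.rTensor k
            (B.counitZero.lTensor _ y) =
          B.counitZero.lTensor _
            ((ChainCoalgebra.cotensor B.right (B.power (n + 1)).coact).subtype.rTensor
              (B.power 0).carrier y) := by
        intro y
        rw [← LinearMap.comp_apply, ← LinearMap.comp_apply, LinearMap.lTensor_comp_rTensor,
          LinearMap.rTensor_comp_lTensor]
      have h2 : ∀ y : M ⊗[k] ((B.power (n + 1)).carrier ⊗[k] (B.power 0).carrier),
          B.counitZero.lTensor (M ⊗[k] (B.power (n + 1)).carrier)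
            ((assoc k M (B.power (n + 1)).carrier (B.power 0).carrier).symm y) =
          (assoc k M (B.power (n + 1)).carrier k).symm
            ((B.counitZero.lTensor (B.power (n + 1)).carrier).lTensor M y) := by
        intro y
        rw [LinearEquiv.eq_symm_apply]
        induction y with
        | zero => simp
        | add a b ha hb => simp only [map_add, ha, hb]
        | tmul a b =>
          induction b with
          | zero => simp
          | add a b ha hb => simp only [map_add, TensorProduct.tmul_add, ha, hb]
          | tmul c d => simp
      have h3 : ∀ y : M ⊗[k] (B.power (n + 1)).carrier,
          (assoc k M (B.power (n + 1)).carrier k).symm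
            (((TensorProduct.mk k (B.power (n + 1)).carrier k).flip 1).lTensor M y) =
          y ⊗ₜ[k] (1 : k) := by
        intro y
        induction y with
        | zero => simp
        | add a b ha hb => simp only [map_add, TensorProduct.add_tmul, ha, hb]
        | tmul a b => simp
      have h4 : ∀ y : M ⊗[k] (B.power (n + 1)).carrier,
          (B.counitZero.lTensor (B.power (n + 1)).carrier).lTensor M
            ((B.part (n + 1) 0 (n + 1)).lTensor M y) =
          ((TensorProduct.mk k (B.power (n + 1)).carrier k).flip 1).lTensor M y := by
        intro y
        rw [← LinearMap.comp_apply, ← LinearMap.lTensor_comp, ih]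
      refine (h1 _).trans ?_
      refine (congrArg _ (B.part_succ n 0 n (by omega) x)).trans ?_
      refine (h2 _).trans ?_
      exact (congrArg _ (h4 _)).trans (h3 _)

/-- The cotensor coalgebra `T_C(M) = ⨁ₙ M^{□ n}`. -/
def CotensorCoalgebra (B : Bicomodule k C M) : Type v :=
  DirectSum ℕ (fun n => (B.power n).carrier)

namespace CotensorCoalgebra

variable (B : Bicomodule k C M)

noncomputable instance : AddCommGroup (CotensorCoalgebra B) :=
  inferInstanceAs (AddCommGroup (DirectSum ℕ (fun n => (B.power n).carrier)))

noncomputable instance : Module k (CotensorCoalgebra B) :=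
  inferInstanceAs (Module k (DirectSum ℕ (fun n => (B.power n).carrier)))

/-- The inclusion of the `n`-th cotensor power. -/
noncomputable def ι (n : ℕ) : (B.power n).carrier →ₗ[k] CotensorCoalgebra B :=
  DirectSum.lof k ℕ (fun m => (B.power m).carrier) n

variable {B} in
theorem hom_ext {X : Type*} [AddCommGroup X] [Module k X] {f g : CotensorCoalgebra B →ₗ[k] X}
    (h : ∀ n, f ∘ₗ ι B n = g ∘ₗ ι B n) : f = g :=
  DirectSum.linearMap_ext k h

/-- On `M^{□ n}` the comultiplication is the sum over `i + j = n` of its components in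
`M^{□ i} ⊗ M^{□ j}`, and the counit is that of `C` on `M^{□ 0} = C` and zero on `M^{□ n}`,
`n > 0`. -/
noncomputable instance : CoalgebraStruct k (CotensorCoalgebra B) where
  comul := DirectSum.toModule k ℕ _ fun n =>
    ∑ p ∈ Finset.HasAntidiagonal.antidiagonal n, map (ι B p.1) (ι B p.2) ∘ₗ B.part p.1 p.2 n
  counit := B.counitZero ∘ₗ
    DirectSum.component k ℕ (fun m => (B.power m).carrier) 0

theorem comul_ι (n : ℕ) (x : (B.power n).carrier) :
    CoalgebraStruct.comul (R := k) (ι B n x) =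
      ∑ p ∈ Finset.HasAntidiagonal.antidiagonal n, map (ι B p.1) (ι B p.2) (B.part p.1 p.2 n x) := by
  refine (DirectSum.toModule_lof (M := fun m => (B.power m).carrier) k n x).trans ?_
  simp [LinearMap.sum_apply]

theorem counit_ι_zero (x : (B.power 0).carrier) :
    CoalgebraStruct.counit (R := k) (ι B 0 x) = B.counitZero x :=
  congrArg B.counitZero
    (DirectSum.component.lof_self k (M := fun m => (B.power m).carrier) 0 x)

theorem counit_ι_of_ne (n : ℕ) (hn : n ≠ 0) (x : (B.power n).carrier) :
    CoalgebraStruct.counit (R := k) (ι B n x) = 0 := by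
  have : DirectSum.component k ℕ (fun m => (B.power m).carrier) 0
      (DirectSum.lof k ℕ (fun m => (B.power m).carrier) n x) = 0 := by
    rw [DirectSum.component.of, dif_neg hn]
  exact (congrArg B.counitZero this).trans
    (map_zero B.counitZero)

theorem rTensor_comul_ι (m l : ℕ) (z : (B.power m).carrier ⊗[k] (B.power l).carrier) :
    (CoalgebraStruct.comul (R := k) (A := CotensorCoalgebra B)).rTensor (CotensorCoalgebra B)
        (map (ι B m) (ι B l) z) =
      ∑ p ∈ Finset.HasAntidiagonal.antidiagonal m, map (map (ι B p.1) (ι B p.2)) (ι B l)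
        ((B.part p.1 p.2 m).rTensor (B.power l).carrier z) := by
  induction z with
  | zero => simp
  | add a b ha hb => simp only [map_add, ha, hb, Finset.sum_add_distrib]
  | tmul a b =>
    simp only [TensorProduct.map_tmul, LinearMap.rTensor_tmul, comul_ι, TensorProduct.sum_tmul]

theorem lTensor_comul_ι (m l : ℕ) (z : (B.power m).carrier ⊗[k] (B.power l).carrier) :
    (CoalgebraStruct.comul (R := k) (A := CotensorCoalgebra B)).lTensor (CotensorCoalgebra B)
        (map (ι B m) (ι B l) z) =
      ∑ p ∈ Finset.HasAntidiagonal.antidiagonal l, map (ι B m) (map (ι B p.1) (ι B p.2))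
        ((B.part p.1 p.2 l).lTensor (B.power m).carrier z) := by
  induction z with
  | zero => simp
  | add a b ha hb => simp only [map_add, ha, hb, Finset.sum_add_distrib]
  | tmul a b =>
    simp only [TensorProduct.map_tmul, LinearMap.lTensor_tmul, comul_ι, TensorProduct.tmul_sum]

theorem rTensor_counit_ι_zero (l : ℕ) (z : (B.power 0).carrier ⊗[k] (B.power l).carrier) :
    (CoalgebraStruct.counit (R := k) (A := CotensorCoalgebra B)).rTensor (CotensorCoalgebra B)
        (map (ι B 0) (ι B l) z) =
      (ι B l).lTensor k (B.counitZero.rTensor (B.power l).carrier z) := by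
  induction z with
  | zero => simp
  | add a b ha hb => simp only [map_add, ha, hb]
  | tmul a b =>
    simp only [TensorProduct.map_tmul, LinearMap.rTensor_tmul, LinearMap.lTensor_tmul,
      counit_ι_zero]

theorem rTensor_counit_ι_of_ne (m l : ℕ) (hm : m ≠ 0)
    (z : (B.power m).carrier ⊗[k] (B.power l).carrier) :
    (CoalgebraStruct.counit (R := k) (A := CotensorCoalgebra B)).rTensor (CotensorCoalgebra B)
        (map (ι B m) (ι B l) z) = 0 := by
  induction z with
  | zero => simp
  | add a b ha hb => simp only [map_add, ha, hb, add_zero]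
  | tmul a b => simp [counit_ι_of_ne B m hm]

theorem lTensor_counit_ι_zero (m : ℕ) (z : (B.power m).carrier ⊗[k] (B.power 0).carrier) :
    (CoalgebraStruct.counit (R := k) (A := CotensorCoalgebra B)).lTensor (CotensorCoalgebra B)
        (map (ι B m) (ι B 0) z) =
      (ι B m).rTensor k (B.counitZero.lTensor (B.power m).carrier z) := by
  induction z with
  | zero => simp
  | add a b ha hb => simp only [map_add, ha, hb]
  | tmul a b =>
    simp only [TensorProduct.map_tmul, LinearMap.rTensor_tmul, LinearMap.lTensor_tmul,
      counit_ι_zero]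

theorem lTensor_counit_ι_of_ne (m l : ℕ) (hl : l ≠ 0)
    (z : (B.power m).carrier ⊗[k] (B.power l).carrier) :
    (CoalgebraStruct.counit (R := k) (A := CotensorCoalgebra B)).lTensor (CotensorCoalgebra B)
        (map (ι B m) (ι B l) z) = 0 := by
  induction z with
  | zero => simp
  | add a b ha hb => simp only [map_add, ha, hb, add_zero]
  | tmul a b => simp [counit_ι_of_ne B l hl]

noncomputable instance : Coalgebra k (CotensorCoalgebra B) where
  coassoc := by
    refine hom_ext fun n => LinearMap.ext fun x => ?_
    simp only [LinearMap.comp_apply, LinearEquiv.coe_coe, comul_ι, map_sum, rTensor_comul_ι,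
      lTensor_comul_ι, ← TensorProduct.map_map_assoc]
    rw [Finset.sum_sigma', Finset.sum_sigma']
    refine Finset.sum_nbij' (fun ⟨⟨_, l⟩, ⟨i, j⟩⟩ => ⟨(i, j + l), (j, l)⟩)
      (fun ⟨⟨i, _⟩, ⟨j, l⟩⟩ => ⟨(i + j, l), (i, j)⟩) ?_ ?_ ?_ ?_ ?_
    · rintro ⟨⟨a, b⟩, ⟨c, d⟩⟩ h
      simp at h ⊢
      omega
    · rintro ⟨⟨a, b⟩, ⟨c, d⟩⟩ h
      simp at h ⊢
      omega
    · rintro ⟨⟨a, b⟩, ⟨c, d⟩⟩ h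
      simp at h ⊢
      exact h.2
    · rintro ⟨⟨a, b⟩, ⟨c, d⟩⟩ h
      simp at h ⊢
      exact h.2
    · rintro ⟨⟨m, l⟩, ⟨i, j⟩⟩ h
      simp only [Finset.mem_sigma, Finset.HasAntidiagonal.mem_antidiagonal] at h
      have := LinearMap.congr_fun (B.part_coassoc i j l m (j + l) n (by omega) (by omega)
        (by omega) (by omega)) x
      exact congrArg (map (ι B i) (map (ι B j) (ι B l))) this
  rTensor_counit_comp_comul := by
    refine hom_ext fun n => LinearMap.ext fun x => ?_
    simp only [LinearMap.comp_apply, comul_ι, map_sum]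
    rw [Finset.sum_eq_single (0, n)]
    · refine (rTensor_counit_ι_zero B n _).trans ?_
      have := LinearMap.congr_fun (B.part_counit_left n) x
      exact congrArg ((ι B n).lTensor k) this
    · rintro ⟨i, j⟩ h1 h2
      refine rTensor_counit_ι_of_ne B i j ?_ _
      rintro rfl
      simp at h1
      simp [h1] at h2
    · simp
  lTensor_counit_comp_comul := by
    refine hom_ext fun n => LinearMap.ext fun x => ?_
    simp only [LinearMap.comp_apply, comul_ι, map_sum]
    rw [Finset.sum_eq_single (n, 0)]
    · refine (lTensor_counit_ι_zero B n _).trans ?_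
      have := LinearMap.congr_fun (B.part_counit_right n) x
      exact congrArg ((ι B n).rTensor k) this
    · rintro ⟨i, j⟩ h1 h2
      refine lTensor_counit_ι_of_ne B i j ?_ _
      rintro rfl
      simp at h1
      simp [h1] at h2
    · simp

end CotensorCoalgebra
end Powers
end Comodules
section Duals

variable {k : Type u} [Field k] {A B E X Y Z : Type v} [AddCommGroup A] [Module k A]
  [AddCommGroup B] [Module k B] [AddCommGroup E] [Module k E] [AddCommGroup X] [Module k X]
  [AddCommGroup Y] [Module k Y] [AddCommGroup Z] [Module k Z]
  [FiniteDimensional k A] [FiniteDimensional k B]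

/-- The map `X^* → (A ⊗ B)^* ≅ A^* ⊗ B^*` dual to `μ : A ⊗ B → X`, for finite dimensional
`A` and `B`. -/
noncomputable def dualSplit (μ : A ⊗[k] B →ₗ[k] X) :
    Module.Dual k X →ₗ[k] Module.Dual k A ⊗[k] Module.Dual k B :=
  (TensorProduct.dualDistribEquiv k A B).symm.toLinearMap ∘ₗ μ.dualMap

theorem dualDistribEquiv_dualSplit (μ : A ⊗[k] B →ₗ[k] X) (f : Module.Dual k X) (t : A ⊗[k] B) :
    TensorProduct.dualDistribEquiv k A B (dualSplit μ f) t = f (μ t) := by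
  exact congrArg (fun g : Module.Dual k (A ⊗[k] B) => g t)
    ((TensorProduct.dualDistribEquiv k A B).apply_symm_apply (μ.dualMap f))

theorem dualDistribEquiv_tmul (f : Module.Dual k A) (g : Module.Dual k B) (a : A) (b : B) :
    TensorProduct.dualDistribEquiv k A B (f ⊗ₜ g) (a ⊗ₜ b) = f a * g b :=
  TensorProduct.dualDistrib_apply f g a b

theorem dualSplit_coassoc [FiniteDimensional k E] [FiniteDimensional k X] [FiniteDimensional k Z]
    (μ₁ : A ⊗[k] B →ₗ[k] X) (μ₂ : X ⊗[k] E →ₗ[k] Y)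
    (ν₁ : B ⊗[k] E →ₗ[k] Z) (ν₂ : A ⊗[k] Z →ₗ[k] Y)
    (h : ∀ a b e, μ₂ (μ₁ (a ⊗ₜ b) ⊗ₜ e) = ν₂ (a ⊗ₜ ν₁ (b ⊗ₜ e))) :
    (assoc k (Module.Dual k A) (Module.Dual k B) (Module.Dual k E)).toLinearMap ∘ₗ
        (dualSplit μ₁).rTensor (Module.Dual k E) ∘ₗ dualSplit μ₂ =
      (dualSplit ν₁).lTensor (Module.Dual k A) ∘ₗ dualSplit ν₂ := by
  refine LinearMap.ext fun f => ?_
  apply ((LinearEquiv.lTensor (Module.Dual k A) (TensorProduct.dualDistribEquiv k B E)).trans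
    (TensorProduct.dualDistribEquiv k A (B ⊗[k] E))).injective
  refine TensorProduct.ext_threefold' fun a b e => ?_
  have h1 : ∀ w : Module.Dual k X ⊗[k] Module.Dual k E,
      TensorProduct.dualDistribEquiv k A (B ⊗[k] E)
        ((TensorProduct.dualDistribEquiv k B E).toLinearMap.lTensor (Module.Dual k A)
          (assoc k _ _ _ ((dualSplit μ₁).rTensor (Module.Dual k E) w))) (a ⊗ₜ (b ⊗ₜ e)) =
      TensorProduct.dualDistribEquiv k X E w (μ₁ (a ⊗ₜ b) ⊗ₜ e) := by
    intro w
    induction w with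
    | zero => simp
    | add x y hx hy => simp only [map_add, LinearMap.add_apply, hx, hy]
    | tmul g l =>
      rw [LinearMap.rTensor_tmul, dualDistribEquiv_tmul, ← dualDistribEquiv_dualSplit]
      generalize dualSplit μ₁ g = z
      induction z with
      | zero => simp
      | add x y hx hy =>
        simp only [map_add, LinearMap.add_apply, TensorProduct.add_tmul, hx, hy, add_mul]
      | tmul p q =>
        simp only [TensorProduct.assoc_tmul, LinearMap.lTensor_tmul, dualDistribEquiv_tmul,
          LinearEquiv.coe_coe, mul_assoc]
  have h2 : ∀ w : Module.Dual k A ⊗[k] Module.Dual k Z,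
      TensorProduct.dualDistribEquiv k A (B ⊗[k] E)
        ((TensorProduct.dualDistribEquiv k B E).toLinearMap.lTensor (Module.Dual k A)
          ((dualSplit ν₁).lTensor (Module.Dual k A) w)) (a ⊗ₜ (b ⊗ₜ e)) =
      TensorProduct.dualDistribEquiv k A Z w (a ⊗ₜ ν₁ (b ⊗ₜ e)) := by
    intro w
    induction w with
    | zero => simp
    | add x y hx hy => simp only [map_add, LinearMap.add_apply, hx, hy]
    | tmul g l =>
      simp only [LinearMap.lTensor_tmul, dualDistribEquiv_tmul, LinearEquiv.coe_coe,
        dualDistribEquiv_dualSplit]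
  refine (h1 _).trans (Eq.trans ?_ (h2 _).symm)
  rw [dualDistribEquiv_dualSplit, dualDistribEquiv_dualSplit, h]

theorem dualSplit_counit_left (μ : A ⊗[k] B →ₗ[k] B) (e : A) (h : ∀ b, μ (e ⊗ₜ b) = b) :
    (Module.Dual.eval k A e).rTensor (Module.Dual k B) ∘ₗ dualSplit μ =
      TensorProduct.mk k k (Module.Dual k B) 1 := by
  refine LinearMap.ext fun f => ?_
  apply (TensorProduct.lid k (Module.Dual k B)).injective
  refine LinearMap.ext fun b => ?_
  have h1 : ∀ w : Module.Dual k A ⊗[k] Module.Dual k B,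
      TensorProduct.lid k (Module.Dual k B) ((Module.Dual.eval k A e).rTensor _ w) b =
      TensorProduct.dualDistribEquiv k A B w (e ⊗ₜ b) := by
    intro w
    induction w with
    | zero => simp
    | add x y hx hy => simp only [map_add, LinearMap.add_apply, hx, hy]
    | tmul g l => simp
  refine (h1 _).trans ?_
  rw [dualDistribEquiv_dualSplit, h]
  simp

theorem dualSplit_counit_right (μ : B ⊗[k] A →ₗ[k] B) (e : A) (h : ∀ b, μ (b ⊗ₜ e) = b) :
    (Module.Dual.eval k A e).lTensor (Module.Dual k B) ∘ₗ dualSplit μ =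
      (TensorProduct.mk k (Module.Dual k B) k).flip 1 := by
  refine LinearMap.ext fun f => ?_
  apply (TensorProduct.rid k (Module.Dual k B)).injective
  refine LinearMap.ext fun b => ?_
  have h1 : ∀ w : Module.Dual k B ⊗[k] Module.Dual k A,
      TensorProduct.rid k (Module.Dual k B) ((Module.Dual.eval k A e).lTensor _ w) b =
      TensorProduct.dualDistribEquiv k B A w (b ⊗ₜ e) := by
    intro w
    induction w with
    | zero => simp
    | add x y hx hy => simp only [map_add, LinearMap.add_apply, hx, hy]
    | tmul g l => simp [mul_comm]
  refine (h1 _).trans ?_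
  rw [dualDistribEquiv_dualSplit, h]
  simp

end Duals

section Actions

variable (k : Type u) [Field k] (D : Type v) [Ring D] [Algebra k D] (M : Type v) [AddCommGroup M]
  [Module k M]

/-- The left action `D ⊗ M → M`, `d ⊗ m ↦ d m`. -/
noncomputable def leftAction [Module D M] [IsScalarTower k D M] : D ⊗[k] M →ₗ[k] M :=
  TensorProduct.lift (Algebra.lsmul k k M : D →ₐ[k] Module.End k M).toLinearMap

/-- The right action `M ⊗ D → M`, `m ⊗ d ↦ m d`. -/
noncomputable def rightAction [Module Dᵐᵒᵖ M] [IsScalarTower k Dᵐᵒᵖ M] :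
    M ⊗[k] D →ₗ[k] M :=
  TensorProduct.lift ((Algebra.lsmul k k M : Dᵐᵒᵖ →ₐ[k] Module.End k M).toLinearMap ∘ₗ
    (MulOpposite.opLinearEquiv k).toLinearMap).flip

@[simp] theorem leftAction_tmul [Module D M] [IsScalarTower k D M] (d : D) (m : M) :
    leftAction k D M (d ⊗ₜ m) = d • m := by
  simp [leftAction]

@[simp] theorem rightAction_tmul [Module Dᵐᵒᵖ M] [IsScalarTower k Dᵐᵒᵖ M]
    (d : D) (m : M) :
    rightAction k D M (m ⊗ₜ d) = MulOpposite.op d • m := by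
  simp [rightAction]

end Actions

section DualCoalgebra

variable (k : Type u) [Field k] (D : Type v) [Ring D] [Algebra k D] [FiniteDimensional k D]

/-- The dual coalgebra `D^*` of a finite dimensional algebra `D`: the comultiplication is dual to
the multiplication, and the counit is evaluation at `1`. -/
noncomputable instance dualCoalgebra : Coalgebra k (Module.Dual k D) where
  comul := dualSplit (LinearMap.mul' k D)
  counit := Module.Dual.eval k D 1
  coassoc := dualSplit_coassoc _ _ _ _ (by simp [mul_assoc])
  rTensor_counit_comp_comul := dualSplit_counit_left _ _ (by simp)
  lTensor_counit_comp_comul := dualSplit_counit_right _ _ (by simp)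

variable (M : Type v) [AddCommGroup M] [Module k M] [Module D M] [Module Dᵐᵒᵖ M]
  [SMulCommClass D Dᵐᵒᵖ M] [IsScalarTower k D M] [IsScalarTower k Dᵐᵒᵖ M] [FiniteDimensional k M]

/-- The `D^*`-bicomodule `M^*` dual to a finite dimensional `D`-bimodule `M`. -/
noncomputable def dualBicomodule : Bicomodule k (Module.Dual k D) (Module.Dual k M) where
  left := dualSplit (leftAction k D M)
  right := dualSplit (rightAction k D M)
  left_coassoc := dualSplit_coassoc _ _ _ _ (by simp [mul_smul])
  left_counit := dualSplit_counit_left _ _ (by simp)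
  right_coassoc := dualSplit_coassoc _ _ _ _ (by simp [mul_smul])
  right_counit := dualSplit_counit_right _ _ (by simp)
  left_right := dualSplit_coassoc _ _ _ _ (by simp [smul_comm])

end DualCoalgebra

section DC

variable {k : Type u} [Field k] {D : Type v} [DivisionRing D] [Algebra k D]

/-- The `D`-bimodule `D_α`: the vector space `D` with `a ▷ x = a x` and `x ◁ b = x α(b)`. -/
def TwistedBimodule (_α : D ≃ₐ[k] D) : Type v := D

variable (α : D ≃ₐ[k] D)

namespace TwistedBimodule

instance : AddCommGroup (TwistedBimodule α) := inferInstanceAs (AddCommGroup D)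

instance : Module k (TwistedBimodule α) := inferInstanceAs (Module k D)

instance : Module D (TwistedBimodule α) := inferInstanceAs (Module D D)

/-- The element of `D_α` given by an element of `D`. -/
def of (x : D) : TwistedBimodule α := x

noncomputable instance : Module Dᵐᵒᵖ (TwistedBimodule α) :=
  Module.compHom D (RingEquiv.op (α : D ≃+* D)).toRingHom

theorem smul_of (a x : D) : a • of α x = of α (a * x) := rfl

theorem op_smul_of (b x : D) : MulOpposite.op b • of α x = of α (x * α b) := rfl

instance : SMulCommClass D Dᵐᵒᵖ (TwistedBimodule α) where
  smul_comm a b x := (mul_assoc a (show D from x) (α b.unop)).symm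

instance : IsScalarTower k D (TwistedBimodule α) := inferInstanceAs (IsScalarTower k D D)

instance : IsScalarTower k Dᵐᵒᵖ (TwistedBimodule α) where
  smul_assoc c b x := by
    have h : (show D from x) * α (c • b.unop) = c • ((show D from x) * α b.unop) := by
      rw [map_smul, mul_smul_comm]
    exact h

instance [FiniteDimensional k D] : FiniteDimensional k (TwistedBimodule α) :=
  inferInstanceAs (FiniteDimensional k D)

end TwistedBimodule

/-- `DC(D, α) = T_{D^*}(D_α^*)`. -/
abbrev DC [FiniteDimensional k D] : Type (max u v) :=
  CotensorCoalgebra (dualBicomodule k D (TwistedBimodule α))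

end DC

end ChainCoalgebra

-- The dual algebra `A = C^*` is a complete skew discrete valuation ring, and `C` is recovered from
-- it. `A` acts on `C` from both sides by `hitL` and `hitR`. Right coideals are the `hitL`-stable
-- subspaces, and since the two actions commute, the kernel and image of each `hitR a` are right
-- coideals. Every element lies in a finite dimensional right coideal, so in a chain coalgebra every
-- proper right coideal is finite dimensional. As `C` is infinite dimensional, every nonzero `a`
-- therefore acts surjectively, and `A` is a domain. The functionals vanishing on the socle form an
-- ideal `J` whose complement consists of units. A nonzero `x` in `J` with smallest kernel generates
-- `J`, because kernels are comparable. `J` acts locally nilpotently, so `A` is `x`-adically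
-- complete and separated, and `D = A/J` is a finite dimensional division algebra
-- (`IsChainCoalgebra.exists_uniformizer`).
--
-- Perfectness of `k` makes `D` separable (`exists_separability_idempotent`). As in the
-- Wedderburn-Malcev theorem, `D` then lifts to a subalgebra `s(D)` of `A`, the Hochschild
-- obstruction being killed one power of `x` at a time (`SkewUniformizer.exists_section`). Averaging
-- `x` against the separability idempotent gives a new uniformizer, again called `x`, with `x s(d) =
-- s(α d) x` (`SkewUniformizer.exists_twist`).
--
-- Dually, `s` and `x` give a coalgebra map `π : C → D^*` and a bicolinear map `C → D_α^*`, hence a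
-- coalgebra map to the cotensor coalgebra (`BicolinearPair.exists_coalgHom`). Each cotensor power
-- embeds in `D^*`, and the `n`-th component becomes `c ↦ π(xⁿ c)`, where `x` acts by `hitR`. Since
-- `A = s(D) ⊕ xA`, `π` identifies the kernel of `x` on `C` with `D^*`. Bijectivity follows by
-- induction, using that `x` is locally nilpotent and surjective on `C` (`nonempty_coalgEquiv_DC`).

universe w

namespace ChainCoalgebra

open scoped TensorProduct

/-! ### Separability of finite dimensional division algebras over a perfect field. -/

section Separable

variable {k D : Type*} [Field k] [DivisionRing D] [Algebra k D]

/-- Every endomorphism of `D` that commutes with multiplication by the center is a combination of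
the maps `y ↦ a y b`. -/
theorem mem_range_mulLeftRight [FiniteDimensional k D] (g : D →ₗ[k] D)
    (hg : ∀ z ∈ Subalgebra.center k D, ∀ y, g (z * y) = z * g y) :
    ∃ t : D ⊗[k] Dᵐᵒᵖ, AlgHom.mulLeftRight k D t = g := by
  let : Module (D ⊗[k] Dᵐᵒᵖ) D := Module.compHom D (AlgHom.mulLeftRight k D).toRingHom
  have smul_def : ∀ (t : D ⊗[k] Dᵐᵒᵖ) (y : D), t • y = AlgHom.mulLeftRight k D t y :=
    fun _ _ => rfl
  have : IsSimpleModule (D ⊗[k] Dᵐᵒᵖ) D := by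
    rw [isSimpleModule_iff_toSpanSingleton_surjective]
    refine ⟨inferInstance, fun m hm y => ⟨(y * m⁻¹) ⊗ₜ 1, ?_⟩⟩
    simp [smul_def, hm]
  -- An endomorphism commutes with all left and right multiplications, so it is multiplication by a
  -- central element. Linearity over the center thus puts `g` in the bicommutant.
  have key : ∀ φ : Module.End (D ⊗[k] Dᵐᵒᵖ) D, φ 1 ∈ Subalgebra.center k D ∧
      ∀ y, φ y = φ 1 * y := by
    intro φ
    have h1 : ∀ y, φ y = y * φ 1 := fun y => by
      simpa [smul_def] using φ.map_smul (y ⊗ₜ 1) 1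
    have h2 : ∀ y, φ y = φ 1 * y := fun y => by
      simpa [smul_def] using φ.map_smul (1 ⊗ₜ MulOpposite.op y) 1
    exact ⟨Subalgebra.mem_center_iff.2 fun y => by rw [← h1, h2], h2⟩
  let f : Module.End (Module.End (D ⊗[k] Dᵐᵒᵖ) D) D :=
    { toFun := g
      map_add' := g.map_add
      map_smul' := fun φ y => by
        have := hg _ (key φ).1 y
        simp only [Module.End.smul_def, RingHom.id_apply]
        rw [(key φ).2, this, (key φ).2 (g y)] }
  let b := Module.finBasis k D
  classical
  -- Density only matches `g` on finitely many vectors, and a `k`-basis of `D` is finite.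
  obtain ⟨t, ht⟩ := jacobson_density f (Finset.univ.image b)
  refine ⟨t, b.ext fun i => ?_⟩
  exact (ht (b i) (by simp)).symm

/-- Retract `D` onto its center `Z` by a `Z`-linear map, multiply by `z`, and include back. By
cyclicity of the trace the result has trace `Tr_{Z/k}(z)`, which is nonzero for some `z` because
`Z/k` is separable. This is the only place where perfectness of `k` is used directly. -/
theorem exists_trace_ne_zero [PerfectField k] [FiniteDimensional k D] :
    ∃ g : D →ₗ[k] D, (∀ z ∈ Subalgebra.center k D, ∀ y, g (z * y) = z * g y) ∧
      LinearMap.trace k D g ≠ 0 := by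
  let _ : Algebra k (Subring.center D) := ((algebraMap k D).codRestrict (Subring.center D)
    fun c => Subring.mem_center_iff.2 fun y => (Algebra.commutes c y).symm).toAlgebra
  have _ : IsScalarTower k (Subring.center D) D := .of_algebraMap_eq fun _ => rfl
  let ι : Subring.center D →ₗ[k] D := (Algebra.linearMap (Subring.center D) D).restrictScalars k
  have hι : Function.Injective ι := Subtype.val_injective
  have _ : FiniteDimensional k (Subring.center D) := .of_injective ι hι
  obtain ⟨φ, hφ⟩ := LinearMap.exists_leftInverse_of_injective
    (Algebra.linearMap (Subring.center D) D) (LinearMap.ker_eq_bot.2 hι)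
  obtain ⟨z, hz⟩ : ∃ z, Algebra.trace k (Subring.center D) z ≠ 0 := by
    by_contra! h
    exact Algebra.trace_ne_zero k (Subring.center D) (LinearMap.ext h)
  let φ' : D →ₗ[k] Subring.center D := φ.restrictScalars k
  refine ⟨ι ∘ₗ LinearMap.mulLeft k z ∘ₗ φ', fun w hw y => ?_, ?_⟩
  · have hw' : w ∈ Subring.center D :=
      Subring.mem_center_iff.2 (Subalgebra.mem_center_iff.1 hw)
    have : φ (w * y) = ⟨w, hw'⟩ * φ y := φ.map_smul ⟨w, hw'⟩ y
    simp only [LinearMap.comp_apply, φ', LinearMap.restrictScalars_apply, this,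
      LinearMap.mulLeft_apply]
    rw [mul_left_comm]
    rfl
  · rw [LinearMap.trace_comp_comm', LinearMap.comp_assoc]
    have : φ' ∘ₗ ι = LinearMap.id := LinearMap.ext fun w => LinearMap.congr_fun hφ w
    rw [this, LinearMap.comp_id]
    exact hz

/-- Symmetry is cyclicity of the trace, as left and right multiplications commute. The factor `u`
makes nonvanishing a consequence of density: if all these traces were zero, every center-linear
endomorphism would have trace zero. -/
theorem exists_symmetric_form [PerfectField k] [FiniteDimensional k D] :
    ∃ (t : D →ₗ[k] k) (u v : D), (∀ a b, t (a * b) = t (b * a)) ∧ t v ≠ 0 ∧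
      ∀ a, t a = LinearMap.trace k D (LinearMap.mulLeft k a ∘ₗ LinearMap.mulRight k u) := by
  have h : ∃ u v : D, LinearMap.trace k D (LinearMap.mulLeft k v ∘ₗ LinearMap.mulRight k u) ≠ 0 := by
    by_contra! h
    obtain ⟨g, hg, hne⟩ := exists_trace_ne_zero (k := k) (D := D)
    obtain ⟨t, rfl⟩ := mem_range_mulLeftRight g hg
    apply hne
    clear hne hg
    induction t with
    | zero => simp
    | add a b ha hb => simp [ha, hb]
    | tmul a b =>
      rw [← h b.unop a]
      congr 1
  obtain ⟨u, v, huv⟩ := h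
  let t : D →ₗ[k] k := LinearMap.trace k D ∘ₗ
    LinearMap.lcomp k D (LinearMap.mulRight k u) ∘ₗ LinearMap.mul k D
  have ht : ∀ a, t a = LinearMap.trace k D (LinearMap.mulLeft k a ∘ₗ LinearMap.mulRight k u) :=
    fun a => rfl
  refine ⟨t, u, v, fun a b => ?_, by rwa [ht], ht⟩
  have e : ∀ a b : D, LinearMap.mulLeft k (a * b) ∘ₗ LinearMap.mulRight k u =
      LinearMap.mulLeft k a ∘ₗ (LinearMap.mulLeft k b ∘ₗ LinearMap.mulRight k u) := by
    intro a b; ext y; simp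
  have e' : ∀ a b : D, LinearMap.mulLeft k (b * a) ∘ₗ LinearMap.mulRight k u =
      (LinearMap.mulLeft k b ∘ₗ LinearMap.mulRight k u) ∘ₗ LinearMap.mulLeft k a := by
    intro a b; ext y; simp [mul_assoc]
  rw [ht, ht, e, e', LinearMap.trace_comp_comm']

/-- A finite dimensional division algebra over a perfect field is separable: it has a separability
idempotent `∑ eᵢ ⊗ fᵢ`. -/
theorem exists_separability_idempotent [PerfectField k] [FiniteDimensional k D] :
    ∃ (n : ℕ) (e f : Fin n → D), ∑ i, e i * f i = 1 ∧
      ∀ d, ∑ i, (d * e i) ⊗ₜ[k] f i = ∑ i, e i ⊗ₜ[k] (f i * d) := by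
  obtain ⟨t, u, v, hsymm, htv, ht⟩ := exists_symmetric_form (k := k) (D := D)
  let B : LinearMap.BilinForm k D := (LinearMap.mul k D).compr₂ t
  have hB : ∀ a b, B a b = t (a * b) := fun a b => rfl
  have hBs : B.IsSymm := ⟨fun a b => hsymm a b⟩
  -- If `a ≠ 0` then `B a (a⁻¹ v) = t v ≠ 0`.
  have hnd : B.Nondegenerate := by
    refine hBs.isRefl.nondegenerate_iff_separatingLeft.2 ?_
    intro a ha
    by_contra hne
    apply htv
    have := ha (a⁻¹ * v)
    rwa [hB, mul_inv_cancel_left₀ hne] at this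
  let e := Module.finBasis k D
  let f := B.dualBasis hnd e
  have hfe : ∀ i j, t (f i * e j) = if j = i then 1 else 0 :=
    LinearMap.BilinForm.apply_dualBasis_left hnd e
  have hex : ∀ y, y = ∑ i, t (f i * y) • e i := by
    intro y
    conv_lhs => rw [← e.sum_repr y]
    refine Finset.sum_congr rfl fun i _ => ?_
    congr 1
    conv_rhs => rw [← e.sum_repr y]
    simp only [Finset.mul_sum, mul_smul_comm, map_sum, map_smul, hfe]
    simp
  have hfx : ∀ y, y = ∑ i, t (y * e i) • f i := by
    intro y
    conv_lhs => rw [← f.sum_repr y]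
    refine Finset.sum_congr rfl fun i _ => ?_
    congr 1
    conv_rhs => rw [← f.sum_repr y]
    simp only [Finset.sum_mul, smul_mul_assoc, map_sum, map_smul, hfe]
    simp
  -- Casimir property of dual bases: in the tensors `e j ⊗ f i` both sides have coefficients `t (f j
  -- * d * e i)`.
  have hcas : ∀ d, ∑ i, (d * e i) ⊗ₜ[k] f i = ∑ i, e i ⊗ₜ[k] (f i * d) := by
    intro d
    have h1 : ∀ i, (d * e i) ⊗ₜ[k] f i = ∑ j, t (f j * d * e i) • (e j ⊗ₜ[k] f i) := by
      intro i
      conv_lhs => rw [hex (d * e i)]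
      simp [TensorProduct.sum_tmul, TensorProduct.smul_tmul', mul_assoc]
    have h2 : ∀ j, e j ⊗ₜ[k] (f j * d) = ∑ i, t (f j * d * e i) • (e j ⊗ₜ[k] f i) := by
      intro j
      conv_lhs => rw [hfx (f j * d)]
      simp [TensorProduct.tmul_sum]
    simp only [h1, h2]
    exact Finset.sum_comm
  -- Inserting `u` between the two legs of the Casimir element gives a central element.
  let γ : D := ∑ i, e i * u * f i
  have hγ : ∀ d, d * γ = γ * d := by
    intro d
    have := congrArg (TensorProduct.lift ((LinearMap.mul k D) ∘ₗ LinearMap.mulRight k u)) (hcas d)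
    simpa [γ, Finset.mul_sum, Finset.sum_mul, mul_assoc] using this
  -- Computing the trace that defines `t v` in the basis `e` yields `t v = t (v γ)`.
  have hγ0 : γ ≠ 0 := by
    intro h0
    apply htv
    have : LinearMap.trace k D (LinearMap.mulLeft k v ∘ₗ LinearMap.mulRight k u) =
        ∑ i, t (v * e i * u * f i) := by
      rw [LinearMap.trace_eq_matrix_trace k e, Matrix.trace]
      refine Finset.sum_congr rfl fun i _ => ?_
      rw [Matrix.diag_apply, LinearMap.toMatrix_apply]
      simp only [LinearMap.comp_apply, LinearMap.mulLeft_apply, LinearMap.mulRight_apply]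
      rw [hsymm]
      conv_lhs => rw [hex (v * (e i * u))]
      simp [Finsupp.single_apply, mul_assoc]
    rw [ht, this, ← map_sum]
    have : ∑ i, v * e i * u * f i = v * γ := by simp [γ, Finset.mul_sum, mul_assoc]
    rw [this, h0, mul_zero, map_zero]
  -- Dividing by the central `γ` normalizes `∑ e i * u * f i` to `1`. Altering the inner side of the
  -- first leg preserves the Casimir property.
  refine ⟨_, fun i => e i * (u * γ⁻¹), f, ?_, fun d => ?_⟩
  · have hγi : ∀ d, d * γ⁻¹ = γ⁻¹ * d := fun d =>
      ((show Commute d γ from hγ d).inv_right₀ : Commute d γ⁻¹)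
    have : ∀ i, e i * (u * γ⁻¹) * f i = (e i * u * f i) * γ⁻¹ := fun i => by
      rw [hγi, ← hγi u]
      simp only [mul_assoc]
      rw [← hγi (f i)]
    simp only [this, ← Finset.sum_mul]
    exact mul_inv_cancel₀ hγ0
  · have := congrArg ((LinearMap.mulRight k (u * γ⁻¹)).rTensor D) (hcas d)
    simpa [mul_assoc] using this

end Separable

/-! ### Lifting the residue division algebra and normalizing the uniformizer. -/

section Lifting

/-- An algebra `A` with a surjection `q` onto `D`, whose kernel is generated by `x` as a right
ideal, and which is `x`-adically complete and separated. -/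
structure SkewUniformizer (k : Type*) {A D : Type*} [Field k] [Ring A] [Algebra k A]
    [DivisionRing D] [Algebra k D] (q : A →ₐ[k] D) (x : A) : Prop where
  surjective : Function.Surjective q
  map_eq_zero_iff : ∀ a, q a = 0 ↔ ∃ b, a = x * b
  isUnit : ∀ a, q a ≠ 0 → IsUnit a
  ne_zero : x ≠ 0
  separated : ∀ a, (∀ n, ∃ b, a = x ^ n * b) → a = 0
  complete : ∀ a : ℕ → A, (∀ n, ∃ b, a (n + 1) - a n = x ^ n * b) →
    ∃ c, ∀ n, ∃ b, c - a n = x ^ n * b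

variable {k A D : Type*} [Field k] [Ring A] [Algebra k A] [DivisionRing D] [Algebra k D]

/-- The right ideal `xⁿ A`. -/
def powIdeal (k : Type*) {A : Type*} [Field k] [Ring A] [Algebra k A] (x : A) (n : ℕ) :
    Submodule k A :=
  LinearMap.range (LinearMap.mulLeft k (x ^ n))

theorem mem_powIdeal {x a : A} {n : ℕ} : a ∈ powIdeal k x n ↔ ∃ b, a = x ^ n * b := by
  simp [powIdeal, eq_comm]

namespace SkewUniformizer

variable {q : A →ₐ[k] D} {x : A} (H : SkewUniformizer k q x)
include H

/-- The right ideal `xA` is the kernel of `q`, hence two-sided. Consequently all `xⁿ A` are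
two-sided and multiply like powers of an ideal. -/
theorem exists_comm (a : A) : ∃ b, a * x = x * b := by
  have hx : q x = 0 := (H.map_eq_zero_iff x).2 ⟨1, by simp⟩
  exact (H.map_eq_zero_iff _).1 (by simp [hx])

theorem exists_comm_pow (n : ℕ) (a : A) : ∃ b, a * x ^ n = x ^ n * b := by
  induction n with
  | zero => exact ⟨a, by simp⟩
  | succ n ih =>
    obtain ⟨b, hb⟩ := ih
    obtain ⟨c, hc⟩ := H.exists_comm b
    exact ⟨c, by rw [pow_succ, ← mul_assoc, hb, mul_assoc, hc, mul_assoc]⟩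

omit H in
theorem powIdeal_mul_right {n : ℕ} {a : A} (ha : a ∈ powIdeal k x n) (b : A) :
    a * b ∈ powIdeal k x n := by
  obtain ⟨c, rfl⟩ := mem_powIdeal.1 ha
  exact mem_powIdeal.2 ⟨c * b, mul_assoc _ _ _⟩

theorem mul_mem_powIdeal {m n : ℕ} {a b : A} (ha : a ∈ powIdeal k x m)
    (hb : b ∈ powIdeal k x n) : a * b ∈ powIdeal k x (m + n) := by
  obtain ⟨c, rfl⟩ := mem_powIdeal.1 ha
  obtain ⟨d, rfl⟩ := mem_powIdeal.1 hb
  obtain ⟨e, he⟩ := H.exists_comm_pow n c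
  refine mem_powIdeal.2 ⟨e * d, ?_⟩
  rw [pow_add, mul_assoc, mul_assoc, ← mul_assoc c, he, mul_assoc]

theorem powIdeal_mul_left {n : ℕ} (a : A) {b : A} (hb : b ∈ powIdeal k x n) :
    a * b ∈ powIdeal k x n := by
  obtain ⟨c, rfl⟩ := mem_powIdeal.1 hb
  obtain ⟨e, he⟩ := H.exists_comm_pow n a
  exact mem_powIdeal.2 ⟨e * c, by rw [← mul_assoc, he, mul_assoc]⟩

omit H in
theorem powIdeal_anti {m n : ℕ} (h : m ≤ n) : powIdeal k x n ≤ powIdeal k x m := by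
  intro a ha
  obtain ⟨c, rfl⟩ := mem_powIdeal.1 ha
  obtain ⟨i, rfl⟩ := Nat.exists_eq_add_of_le h
  exact mem_powIdeal.2 ⟨x ^ i * c, by rw [pow_add, mul_assoc]⟩

theorem mem_powIdeal_one {a : A} : a ∈ powIdeal k x 1 ↔ q a = 0 := by
  rw [mem_powIdeal, H.map_eq_zero_iff, pow_one]

/-- A linear section that is multiplicative modulo `xⁿ⁺¹ A` can be corrected to one that is
multiplicative modulo `xⁿ⁺² A`: the obstruction is a Hochschild 2-cocycle of the separable algebra
`D`. -/
theorem exists_section_step [PerfectField k] [FiniteDimensional k D] (n : ℕ) (s : D →ₗ[k] A)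
    (hq : ∀ d, q (s d) = d) (hs : ∀ a b, s a * s b - s (a * b) ∈ powIdeal k x (n + 1)) :
    ∃ s' : D →ₗ[k] A, (∀ d, q (s' d) = d) ∧
      (∀ a b, s' a * s' b - s' (a * b) ∈ powIdeal k x (n + 2)) ∧
      ∀ d, s' d - s d ∈ powIdeal k x (n + 1) := by
  obtain ⟨m, e, f, hef, hcas⟩ := exists_separability_idempotent (k := k) (D := D)
  let φ : D →ₗ[k] D →ₗ[k] A :=
    (LinearMap.mul k A).compl₁₂ s s - (LinearMap.mul k D).compr₂ s
  have hφ : ∀ a b, φ a b = s a * s b - s (a * b) := fun a b => rfl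
  have hφm : ∀ a b, φ a b ∈ powIdeal k x (n + 1) := hs
  -- Contracting homotopy for Hochschild cochains supplied by the separability idempotent; `s - g`
  -- will be the corrected section.
  let g : D →ₗ[k] A := ∑ i, LinearMap.mulLeft k (s (e i)) ∘ₗ φ (f i)
  have hg : ∀ a, g a = ∑ i, s (e i) * φ (f i) a := fun a => by simp [g, LinearMap.sum_apply]
  have hgm : ∀ a, g a ∈ powIdeal k x (n + 1) := fun a => by
    rw [hg]
    refine Submodule.sum_mem _ fun i _ => ?_
    exact H.powIdeal_mul_left _ (hφm (f i) a)
  have hprod : ∀ {a b}, a ∈ powIdeal k x (n + 1) → b ∈ powIdeal k x (n + 1) →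
      a * b ∈ powIdeal k x (n + 2) := fun ha hb =>
    powIdeal_anti (by omega) (H.mul_mem_powIdeal ha hb)
  -- An exact identity in `A`. Since `s` is multiplicative only up to `φ`, the cocycle `φ` equals
  -- the coboundary of `g` up to two error terms: one carries the factor `1 - ∑ s (e i) * s (f i)`,
  -- which lies in `xA`, and the other is quadratic in `φ`.
  have hid : ∀ a b, φ a b - (s a * g b - g (a * b) + g a * s b) =
      (1 - ∑ i, s (e i) * s (f i)) * φ a b - ∑ i, φ a (e i) * φ (f i) b := by
    intro a b
    have h1 : ∑ i, s (a * e i) * φ (f i) b = ∑ i, s (e i) * φ (f i * a) b := by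
      have := congrArg (TensorProduct.lift ((LinearMap.mul k A).compl₁₂ s (φ.flip b))) (hcas a)
      simpa using this
    have h2 : s a * g b = ∑ i, φ a (e i) * φ (f i) b + ∑ i, s (a * e i) * φ (f i) b := by
      rw [hg, Finset.mul_sum, ← Finset.sum_add_distrib]
      refine Finset.sum_congr rfl fun i _ => ?_
      rw [hφ a (e i)]
      noncomm_ring
    -- The 2-cocycle identity for `φ`, which is associativity in `A` and `D`.
    have h3 : ∀ i, s (e i) * φ (f i * a) b =
        s (e i) * s (f i) * φ a b + s (e i) * φ (f i) (a * b) - s (e i) * φ (f i) a * s b := by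
      intro i
      simp only [hφ, mul_assoc (f i)]
      noncomm_ring
    rw [h2, h1, Finset.sum_congr rfl fun i _ => h3 i, Finset.sum_sub_distrib,
      Finset.sum_add_distrib, ← Finset.sum_mul, ← Finset.sum_mul, ← hg, ← hg, sub_mul, one_mul]
    abel
  have hcob : ∀ a b, φ a b - (s a * g b - g (a * b) + g a * s b) ∈ powIdeal k x (n + 2) := by
    intro a b
    rw [hid]
    refine Submodule.sub_mem _ ?_ (Submodule.sum_mem _ fun i _ => hprod (hφm _ _) (hφm _ _))
    have h1 : 1 - ∑ i, s (e i) * s (f i) ∈ powIdeal k x 1 := by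
      rw [H.mem_powIdeal_one]
      simp [hq, hef]
    have := H.mul_mem_powIdeal h1 (hφm a b)
    rwa [show 1 + (n + 1) = n + 2 by ring] at this
  refine ⟨s - g, fun d => ?_, fun a b => ?_, fun d => ?_⟩
  · have := H.mem_powIdeal_one.1 (powIdeal_anti (Nat.le_add_left 1 n) (hgm d))
    simp [this, hq]
  · have : (s - g) a * (s - g) b - (s - g) (a * b) =
        φ a b - (s a * g b - g (a * b) + g a * s b) + g a * g b := by
      simp only [LinearMap.sub_apply, hφ]
      noncomm_ring
    rw [this]
    exact Submodule.add_mem _ (hcob a b) (hprod (hgm a) (hgm b))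
  · simpa using hgm d

/-- The projection `q` has a multiplicative section. -/
theorem exists_section [PerfectField k] [FiniteDimensional k D] :
    ∃ s : D →ₐ[k] A, ∀ d, q (s d) = d := by
  obtain ⟨s₀, hs₀⟩ := LinearMap.exists_rightInverse_of_surjective q.toLinearMap
    (LinearMap.range_eq_top.2 H.surjective)
  have hs₀ : ∀ d, q (s₀ d) = d := fun d => LinearMap.congr_fun hs₀ d
  let P : ℕ → Type _ := fun n => {s : D →ₗ[k] A // (∀ d, q (s d) = d) ∧
    ∀ a b, s a * s b - s (a * b) ∈ powIdeal k x (n + 1)}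
  have step : ∀ n (s : P n), ∃ s' : P (n + 1), ∀ d, s'.1 d - s.1 d ∈ powIdeal k x (n + 1) := by
    intro n s
    obtain ⟨s', h1, h2, h3⟩ := H.exists_section_step n s.1 s.2.1 s.2.2
    exact ⟨⟨s', h1, h2⟩, h3⟩
  choose next hnext using step
  -- Stage `n` is multiplicative modulo `xⁿ⁺¹ A`. Stage `0` may be any linear section, since its
  -- defect lies in the kernel of `q`, which is `xA`.
  let S : (n : ℕ) → P n := fun n => Nat.rec
    ⟨s₀, hs₀, fun a b => H.mem_powIdeal_one.2 (by simp [hs₀])⟩ next n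
  have hS : ∀ n d, (S (n + 1)).1 d - (S n).1 d ∈ powIdeal k x (n + 1) := fun n => hnext n (S n)
  let b := Module.finBasis k D
  -- Limits are taken only on a finite basis and extended linearly; the error stays in `xⁿ A`
  -- because this is a subspace.
  have hlim : ∀ i, ∃ c, ∀ n, c - (S n).1 (b i) ∈ powIdeal k x n := fun i => by
    obtain ⟨c, hc⟩ := H.complete (fun n => (S n).1 (b i))
      fun n => mem_powIdeal.1 (powIdeal_anti n.le_succ (hS n (b i)))
    exact ⟨c, fun n => mem_powIdeal.2 (hc n)⟩
  choose c hc using hlim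
  let s : D →ₗ[k] A := b.constr k c
  have hs : ∀ n d, s d - (S n).1 d ∈ powIdeal k x n := by
    intro n d
    have : s d - (S n).1 d = ∑ i, b.repr d i • (c i - (S n).1 (b i)) := by
      conv_lhs => rw [← b.sum_repr d]
      simp only [map_sum, map_smul, smul_sub, Finset.sum_sub_distrib, s,
        Module.Basis.constr_basis]
    rw [this]
    exact Submodule.sum_mem _ fun i _ => Submodule.smul_mem _ _ (hc i n)
  have hqs : ∀ d, q (s d) = d := fun d => by
    have := H.mem_powIdeal_one.1 (hs 1 d)
    rwa [map_sub, (S 1).2.1, sub_eq_zero] at this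
  have hmul : ∀ a b, s (a * b) = s a * s b := by
    intro a b
    refine (sub_eq_zero.1 (H.separated _ fun n => (mem_powIdeal (k := k)).1 ?_)).symm
    have : s a * s b - s (a * b) = (s a - (S n).1 a) * s b + (S n).1 a * (s b - (S n).1 b) +
        ((S n).1 a * (S n).1 b - (S n).1 (a * b)) - (s (a * b) - (S n).1 (a * b)) := by
      noncomm_ring
    rw [this]
    refine Submodule.sub_mem _ (Submodule.add_mem _ (Submodule.add_mem _
      (powIdeal_mul_right (hs n a) _) (H.powIdeal_mul_left _ (hs n b))) (powIdeal_anti n.le_succ ((S n).2.2 a b))) (hs n _)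
  -- Multiplicativity makes `s 1` idempotent, and it is a unit because its residue is `1`.
  have hone : s 1 = 1 := by
    have h1 : s 1 * s 1 = s 1 := by rw [← hmul, one_mul]
    have hu : IsUnit (s 1) := H.isUnit _ (by simp [hqs])
    exact hu.mul_left_cancel (by rw [h1, mul_one])
  exact ⟨AlgHom.ofLinearMap s hone hmul, hqs⟩

/-- The uniformizer can be chosen to normalize the image of the section. -/
theorem exists_twist [PerfectField k] [FiniteDimensional k D] [NoZeroDivisors A] (s : D →ₐ[k] A)
    (hs : ∀ d, q (s d) = d) :
    ∃ (α : D ≃ₐ[k] D) (u : A), IsUnit u ∧ ∀ d, x * u * s d = s (α d) * (x * u) := by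
  obtain ⟨m, e, f, hef, hcas⟩ := exists_separability_idempotent (k := k) (D := D)
  have hcancel : ∀ {a b}, x * a = x * b → a = b := fun h => mul_left_cancel₀ H.ne_zero h
  -- `s(d) x = x σ(d)` determines `σ(d)`, as `x` can be cancelled on the left; all algebra map
  -- properties of `τ = q ∘ σ` follow by this cancellation.
  choose σ hσ using fun d => H.exists_comm (s d)
  let τ : D →ₐ[k] D := AlgHom.ofLinearMap
    { toFun := fun d => q (σ d)
      map_add' := fun a b => by
        rw [← map_add]
        congr 1
        apply hcancel
        rw [← hσ, map_add, add_mul, hσ, hσ, mul_add]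
      map_smul' := fun c a => by
        rw [RingHom.id_apply, ← map_smul]
        congr 1
        apply hcancel
        rw [← hσ, map_smul, smul_mul_assoc, hσ, mul_smul_comm] }
    (by
      show q (σ 1) = 1
      refine (congrArg q (hcancel ?_)).trans (map_one q)
      rw [← hσ, map_one, one_mul, mul_one])
    (fun a b => by
      show q (σ (a * b)) = q (σ a) * q (σ b)
      rw [← map_mul]
      congr 1
      apply hcancel
      rw [← hσ, map_mul, mul_assoc, hσ, ← mul_assoc, hσ, mul_assoc])
  have hτ : ∀ d, τ d = q (σ d) := fun d => rfl
  have hτi : Function.Injective τ := τ.toRingHom.injective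
  have hτb : Function.Bijective τ :=
    ⟨hτi, LinearMap.injective_iff_surjective (f := τ.toLinearMap).1 hτi⟩
  let α := (AlgEquiv.ofBijective τ hτb).symm
  have hα : ∀ d, τ (α d) = d := fun d => (AlgEquiv.ofBijective τ hτb).apply_symm_apply d
  -- Chosen so that `x u = ∑ s(eᵢ) x s(τ fᵢ)`, the average of `x` over the separability idempotent.
  -- Its residue is `τ(∑ eᵢ fᵢ) = 1`, so `u` is a unit.
  let u := ∑ i, σ (e i) * s (τ (f i))
  have hu : x * u = ∑ i, s (e i) * x * s (τ (f i)) := by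
    simp only [u, Finset.mul_sum, hσ, mul_assoc]
  have hqu : q u = 1 := by
    simp only [u, map_sum, map_mul, hs, ← hτ]
    rw [← map_one τ, ← hef]
    simp
  refine ⟨α, u, H.isUnit u (by simp [hqu]), fun d => ?_⟩
  -- Moving `α d` across the idempotent turns `s(α d)` on the left into `s(τ(α d)) = s(d)` on the
  -- right.
  have := congrArg (TensorProduct.lift ((LinearMap.mul k A).compl₁₂
    (LinearMap.mulRight k x ∘ₗ s.toLinearMap) (s.toLinearMap ∘ₗ τ.toLinearMap))) (hcas (α d))
  simp only [map_sum, TensorProduct.lift.tmul, LinearMap.compl₁₂_apply, LinearMap.comp_apply,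
    LinearMap.mulRight_apply, AlgHom.toLinearMap_apply, LinearMap.mul_apply', map_mul, hα] at this
  rw [hu, Finset.sum_mul, Finset.mul_sum]
  simpa only [mul_assoc] using this.symm

end SkewUniformizer

end Lifting

/-! ### The convolution algebra `C^*`, its two actions on `C`, and right coideals. -/

section ConvDual

variable {k : Type u} [Field k]

/-- A tensor killed by every functional on its second factor vanishes. -/
theorem eq_zero_of_lTensor_dual {V W : Type*} [AddCommGroup V] [Module k V] [AddCommGroup W]
    [Module k W] (w : V ⊗[k] W)
    (h : ∀ f : W →ₗ[k] k, TensorProduct.rid k V (f.lTensor V w) = 0) : w = 0 := by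
  classical
  let b := Module.Basis.ofVectorSpace k W
  have key : ∀ i (w : V ⊗[k] W), TensorProduct.equivFinsuppOfBasisRight b w i =
      TensorProduct.rid k V ((b.coord i).lTensor V w) := by
    intro i w
    induction w with
    | zero => simp
    | add x y hx hy => simp only [map_add, Finsupp.add_apply, hx, hy]
    | tmul x y => simp
  apply (TensorProduct.equivFinsuppOfBasisRight b).injective
  ext i
  rw [key, h]
  simp

/-- A tensor killed by every functional on its first factor vanishes. -/
theorem eq_zero_of_rTensor_dual {V W : Type*} [AddCommGroup V] [Module k V] [AddCommGroup W]
    [Module k W] (w : V ⊗[k] W)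
    (h : ∀ f : V →ₗ[k] k, TensorProduct.lid k W (f.rTensor W w) = 0) : w = 0 := by
  apply (TensorProduct.comm k V W).injective
  rw [map_zero]
  refine eq_zero_of_lTensor_dual _ fun f => ?_
  rw [← h f]
  clear h
  induction w with
  | zero => simp
  | add x y hx hy => simp only [map_add, hx, hy]
  | tmul x y => simp

variable {C : Type v} [AddCommGroup C] [Module k C] [Coalgebra k C]

/-- The convolution algebra `C^*` of a coalgebra `C`. -/
abbrev ConvDual (k : Type u) (C : Type v) [Field k] [AddCommGroup C] [Module k C]
    [Coalgebra k C] := WithConv (C →ₗ[k] k)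

/-- The left action of `C^*` on `C`: `c ↦ c₁ a(c₂)`. -/
noncomputable def hitL (a : ConvDual k C) : C →ₗ[k] C :=
  (TensorProduct.rid k C).toLinearMap ∘ₗ a.ofConv.lTensor C ∘ₗ Coalgebra.comul

/-- The right action of `C^*` on `C`: `c ↦ a(c₁) c₂`. -/
noncomputable def hitR (a : ConvDual k C) : C →ₗ[k] C :=
  (TensorProduct.lid k C).toLinearMap ∘ₗ a.ofConv.rTensor C ∘ₗ Coalgebra.comul

theorem hitL_apply (a : ConvDual k C) (c : C) :
    hitL a c = TensorProduct.rid k C (a.ofConv.lTensor C (Coalgebra.comul c)) := rfl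

theorem hitR_apply (a : ConvDual k C) (c : C) :
    hitR a c = TensorProduct.lid k C (a.ofConv.rTensor C (Coalgebra.comul c)) := rfl

/-- Adjointness of the action and multiplication. Functionals separate points of `C`, so this
formula and `mul_apply_hitL` reduce the module laws below to associativity and unitality of `C^*`.
Note that `hitR` reverses products. -/
theorem mul_apply_hitR (a b : ConvDual k C) (c : C) :
    (a * b).ofConv c = b.ofConv (hitR a c) := by
  rw [LinearMap.convMul_apply, hitR_apply]
  generalize Coalgebra.comul (R := k) c = w
  induction w with
  | zero => simp
  | add x y hx hy => simp only [map_add, hx, hy]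
  | tmul x y => simp

theorem mul_apply_hitL (a b : ConvDual k C) (c : C) :
    (a * b).ofConv c = a.ofConv (hitL b c) := by
  rw [LinearMap.convMul_apply, hitL_apply]
  generalize Coalgebra.comul (R := k) c = w
  induction w with
  | zero => simp
  | add x y hx hy => simp only [map_add, hx, hy]
  | tmul x y => simp [mul_comm]

theorem eq_of_convDual {x y : C} (h : ∀ f : ConvDual k C, f.ofConv x = f.ofConv y) : x = y := by
  rw [← sub_eq_zero, ← Module.forall_dual_apply_eq_zero_iff k]
  intro f
  rw [map_sub, sub_eq_zero]
  exact h (WithConv.toConv f)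

theorem hitR_mul (a b : ConvDual k C) (c : C) : hitR (a * b) c = hitR b (hitR a c) :=
  eq_of_convDual (k := k) fun f => by
    rw [← mul_apply_hitR, ← mul_apply_hitR, ← mul_apply_hitR, mul_assoc]

theorem hitL_mul (a b : ConvDual k C) (c : C) : hitL (a * b) c = hitL a (hitL b c) :=
  eq_of_convDual (k := k) fun f => by
    rw [← mul_apply_hitL, ← mul_apply_hitL, ← mul_apply_hitL, mul_assoc]

theorem hitL_hitR (a b : ConvDual k C) (c : C) : hitL a (hitR b c) = hitR b (hitL a c) :=
  eq_of_convDual (k := k) fun f => by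
    rw [← mul_apply_hitL, ← mul_apply_hitR, ← mul_apply_hitR, ← mul_apply_hitL, mul_assoc]

theorem hitR_one (c : C) : hitR (1 : ConvDual k C) c = c :=
  eq_of_convDual (k := k) fun f => by rw [← mul_apply_hitR, one_mul]

theorem hitL_one (c : C) : hitL (1 : ConvDual k C) c = c :=
  eq_of_convDual (k := k) fun f => by rw [← mul_apply_hitL, mul_one]

theorem counit_hitR (a : ConvDual k C) (c : C) :
    (1 : ConvDual k C).ofConv (hitR a c) = a.ofConv c := by
  rw [← mul_apply_hitR, mul_one]

theorem counit_hitL (a : ConvDual k C) (c : C) :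
    (1 : ConvDual k C).ofConv (hitL a c) = a.ofConv c := by
  rw [← mul_apply_hitL, one_mul]

theorem hitR_pow (a : ConvDual k C) (n : ℕ) (c : C) : hitR (a ^ n) c = (hitR a ^ n) c := by
  induction n generalizing c with
  | zero => simp [hitR_one]
  | succ n ih => rw [pow_succ, hitR_mul, ih, pow_succ', Module.End.mul_apply]

theorem ofConv_eq_zero_of_hitR {a : ConvDual k C} {c : C} (h : hitR a c = 0) :
    a.ofConv c = 0 := by
  rw [← counit_hitR, h, map_zero]

/-- Right coideals are the subspaces stable under the left action of `C^*`. -/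
theorem isRightCoideal_iff {N : Submodule k C} :
    IsRightCoideal k N ↔ ∀ a : ConvDual k C, ∀ x ∈ N, hitL a x ∈ N := by
  constructor
  · intro h a x hx
    obtain ⟨y, hy⟩ := h x hx
    rw [hitL_apply, ← hy]
    clear hy
    induction y with
    | zero => simp
    | add y z hy hz => simp only [map_add]; exact N.add_mem hy hz
    | tmul y z => simpa using N.smul_mem _ y.2
  · intro h x hx
    -- It suffices that `Δ(x)` dies in `(C ⧸ N) ⊗ C`; a functional `f` on the second factor sends
    -- its image there to the class of `hitL f x`, which is zero.
    have hex := rTensor_exact C (f := N.subtype) (g := N.mkQ)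
      (LinearMap.exact_iff.2 (by simp)) N.mkQ_surjective
    refine (hex _).1 (eq_zero_of_lTensor_dual _ fun f => ?_)
    have h1 : ∀ w : C ⊗[k] C, TensorProduct.rid k (C ⧸ N) (f.lTensor (C ⧸ N)
        (N.mkQ.rTensor C w)) = N.mkQ (TensorProduct.rid k C (f.lTensor C w)) := by
      intro w
      induction w with
      | zero => simp
      | add y z hy hz => simp only [map_add, hy, hz]
      | tmul y z => simp
    rw [h1]
    exact (Submodule.Quotient.mk_eq_zero N).2 (h (WithConv.toConv f) x hx)

/-- The right coideal generated by an element. -/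
noncomputable def orbit (k : Type u) {C : Type v} [Field k] [AddCommGroup C] [Module k C]
    [Coalgebra k C] (c : C) : Submodule k C :=
  LinearMap.range
    ({ toFun := fun a : ConvDual k C => hitL a c
       map_add' := fun a b => by simp [hitL_apply, LinearMap.lTensor_add]
       map_smul' := fun r a => by simp [hitL_apply, LinearMap.lTensor_smul] } :
      ConvDual k C →ₗ[k] C)

theorem mem_orbit {c x : C} : x ∈ orbit k c ↔ ∃ a : ConvDual k C, hitL a c = x := Iff.rfl

theorem self_mem_orbit (c : C) : c ∈ orbit k c := mem_orbit.2 ⟨1, hitL_one c⟩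

theorem isRightCoideal_orbit (c : C) : IsRightCoideal k (orbit k c) := by
  rw [isRightCoideal_iff]
  rintro a _ ⟨b, rfl⟩
  exact ⟨a * b, hitL_mul a b c⟩

/-- Finiteness theorem: every element lies in a finite dimensional right coideal. -/
instance finiteDimensional_orbit (c : C) : FiniteDimensional k (orbit k c) := by
  classical
  let R := Coalgebra.Repr.arbitrary k c
  have hle : orbit k c ≤ Submodule.span k (R.index.image R.left : Set C) := by
    rintro _ ⟨a, rfl⟩
    show hitL a c ∈ _
    rw [hitL_apply, ← R.eq]
    simp only [map_sum, LinearMap.lTensor_tmul, TensorProduct.rid_tmul]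
    refine Submodule.sum_mem _ fun i hi => Submodule.smul_mem _ _ (Submodule.subset_span ?_)
    exact Finset.mem_coe.2 (Finset.mem_image_of_mem _ hi)
  exact Submodule.finiteDimensional_of_le hle

theorem isRightCoideal_ker_hitR (a : ConvDual k C) :
    IsRightCoideal k (LinearMap.ker (hitR a)) := by
  rw [isRightCoideal_iff]
  intro b x hx
  rw [LinearMap.mem_ker] at hx ⊢
  rw [← hitL_hitR, hx, map_zero]

theorem IsRightCoideal.map_hitR {N : Submodule k C} (hN : IsRightCoideal k N)
    (a : ConvDual k C) : IsRightCoideal k (N.map (hitR a)) := by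
  rw [isRightCoideal_iff]
  rintro b _ ⟨x, hx, rfl⟩
  exact ⟨hitL b x, isRightCoideal_iff.1 hN b x hx, (hitL_hitR _ _ _).symm⟩

theorem isRightCoideal_range_hitR (a : ConvDual k C) :
    IsRightCoideal k (LinearMap.range (hitR a)) := by
  rw [isRightCoideal_iff]
  rintro b _ ⟨x, rfl⟩
  exact ⟨hitL b x, (hitL_hitR _ _ _).symm⟩

theorem exists_comp_eq {V W X : Type*} [AddCommGroup V] [Module k V] [AddCommGroup W]
    [Module k W] [AddCommGroup X] [Module k X] {R : V →ₗ[k] W} (hR : Function.Surjective R)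
    (b : V →ₗ[k] X) (h : LinearMap.ker R ≤ LinearMap.ker b) : ∃ c : W →ₗ[k] X, c ∘ₗ R = b := by
  obtain ⟨g, hg⟩ := LinearMap.exists_rightInverse_of_surjective R (LinearMap.range_eq_top.2 hR)
  refine ⟨b ∘ₗ g, LinearMap.ext fun v => ?_⟩
  have h1 : g (R v) - v ∈ LinearMap.ker R := by
    rw [LinearMap.mem_ker, map_sub, sub_eq_zero]
    exact LinearMap.congr_fun hg (R v)
  have h2 := h h1
  rw [LinearMap.mem_ker, map_sub, sub_eq_zero] at h2
  exact h2

/-- `a` divides `b` in `C^*` if `a` acts surjectively and `b` vanishes on the kernel of `a`. -/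
theorem exists_eq_mul {a b : ConvDual k C} (ha : Function.Surjective (hitR a))
    (h : ∀ c, hitR a c = 0 → b.ofConv c = 0) : ∃ u, b = a * u := by
  -- `b = a * u` means `b(c) = u(hitR a c)`: one factors `b` through `hitR a`.
  obtain ⟨u, hu⟩ := exists_comp_eq ha b.ofConv h
  refine ⟨WithConv.toConv u, WithConv.ext (LinearMap.ext fun c => ?_)⟩
  rw [mul_apply_hitR, ← hu]
  rfl

/-- Compatible functionals on an exhaustive increasing sequence of subspaces can be glued. -/
theorem exists_limit {V : Type*} [AddCommGroup V] [Module k V] (K : ℕ → Submodule k V)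
    (hK : Monotone K) (hex : ∀ c, ∃ n, c ∈ K n) (a : ℕ → V →ₗ[k] k)
    (ha : ∀ n, ∀ c ∈ K n, a (n + 1) c = a n c) :
    ∃ l : V →ₗ[k] k, ∀ n, ∀ c ∈ K n, l c = a n c := by
  classical
  have hst : ∀ n m, n ≤ m → ∀ c ∈ K n, a m c = a n c := by
    intro n m hnm
    induction m, hnm using Nat.le_induction with
    | base => intros; rfl
    | succ m hm ih => intro c hc; rw [ha m c (hK hm hc), ih c hc]
  choose N hN using hex
  have hl : ∀ n, ∀ c ∈ K n, a (N c) c = a n c := by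
    intro n c hc
    rcases le_total n (N c) with h | h
    · exact hst _ _ h c hc
    · exact (hst _ _ h c (hN c)).symm
  refine ⟨⟨⟨fun c => a (N c) c, fun c d => ?_⟩, fun r c => ?_⟩, hl⟩
  · have hc := hK (le_max_left (N c) (N d)) (hN c)
    have hd := hK (le_max_right (N c) (N d)) (hN d)
    rw [hl _ c hc, hl _ d hd, hl _ (c + d) (add_mem hc hd), map_add]
  · exact (hl _ (r • c) (Submodule.smul_mem _ r (hN c))).trans (map_smul _ _ _)

end ConvDual

/-! ### The dual of an infinite dimensional chain coalgebra as a skew discrete valuation ring. -/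

section ChainTheory

variable {k : Type u} [Field k] {C : Type v} [AddCommGroup C] [Module k C] [Coalgebra k C]

/-- A proper right coideal of a chain coalgebra is finite dimensional. -/
theorem IsChainCoalgebra.finiteDimensional (hC : IsChainCoalgebra k C) {N : Submodule k C}
    (hN : IsRightCoideal k N) (hne : N ≠ ⊤) : FiniteDimensional k N := by
  obtain ⟨c, -, hc⟩ := SetLike.exists_of_lt hne.lt_top
  rcases hC N (orbit k c) hN (isRightCoideal_orbit c) with h | h
  · exact Submodule.finiteDimensional_of_le h
  · exact absurd (h (self_mem_orbit c)) hc

/-- The kernel of `hitR a` is a proper right coideal, hence finite dimensional. Were the range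
proper it would be finite dimensional too, and so would `C`. -/
theorem IsChainCoalgebra.surjective_hitR (hC : IsChainCoalgebra k C)
    (hinf : ¬ FiniteDimensional k C) {a : ConvDual k C} (ha : a ≠ 0) :
    Function.Surjective (hitR a) := by
  by_contra hs
  have h1 : LinearMap.ker (hitR a) ≠ ⊤ := fun h => ha <| WithConv.ext <| LinearMap.ext fun c =>
    ofConv_eq_zero_of_hitR (LinearMap.mem_ker.1 (h ▸ Submodule.mem_top))
  have h2 : LinearMap.range (hitR a) ≠ ⊤ := fun h => hs (LinearMap.range_eq_top.1 h)
  have := hC.finiteDimensional (isRightCoideal_ker_hitR a) h1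
  have := hC.finiteDimensional (isRightCoideal_range_hitR a) h2
  have : FiniteDimensional k (C ⧸ LinearMap.ker (hitR a)) :=
    (hitR a).quotKerEquivRange.symm.finiteDimensional
  exact hinf (Module.Finite.of_submodule_quotient (LinearMap.ker (hitR a)))

theorem IsChainCoalgebra.noZeroDivisors (hC : IsChainCoalgebra k C)
    (hinf : ¬ FiniteDimensional k C) : NoZeroDivisors (ConvDual k C) where
  eq_zero_or_eq_zero_of_mul_eq_zero {a b} hab := by
    by_contra! h
    apply h.2
    refine WithConv.ext (LinearMap.ext fun c => ?_)
    obtain ⟨d, rfl⟩ := hC.surjective_hitR hinf h.1 c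
    rw [← mul_apply_hitR, hab]
    rfl

/-- The image is a right coideal of no larger dimension, so comparability forces it inside `N`. -/
theorem IsChainCoalgebra.map_hitR_le (hC : IsChainCoalgebra k C) {N : Submodule k C}
    [FiniteDimensional k N] (hN : IsRightCoideal k N) (a : ConvDual k C) :
    N.map (hitR a) ≤ N := by
  rcases hC _ _ (hN.map_hitR a) hN with h | h
  · exact h
  · exact (Submodule.eq_of_le_of_finrank_le h (Submodule.finrank_map_le (hitR a) N)).ge

/-- The socle of a chain coalgebra: a smallest nonzero right coideal. -/
theorem IsChainCoalgebra.exists_socle (hC : IsChainCoalgebra k C) [Nontrivial C] :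
    ∃ S : Submodule k C, IsRightCoideal k S ∧ FiniteDimensional k S ∧ S ≠ ⊥ ∧
      ∀ N : Submodule k C, IsRightCoideal k N → N ≠ ⊥ → S ≤ N := by
  obtain ⟨c, hc⟩ := exists_ne (0 : C)
  let P : Set (Submodule k C) := {S | IsRightCoideal k S ∧ FiniteDimensional k S ∧ S ≠ ⊥}
  have hP : P.Nonempty := ⟨orbit k c, isRightCoideal_orbit c, inferInstance, fun h =>
    hc ((Submodule.mem_bot k).1 (h ▸ self_mem_orbit c))⟩
  obtain ⟨S, ⟨hS1, hS2, hS3⟩, hmin⟩ :=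
    exists_minimalFor_of_wellFoundedLT (· ∈ P) (fun S => Module.finrank k S) hP
  refine ⟨S, hS1, hS2, hS3, fun N hN hne => ?_⟩
  rcases hC S N hS1 hN with h | h
  · exact h
  · have hf : FiniteDimensional k N := Submodule.finiteDimensional_of_le h
    have h1 := hmin (j := N) ⟨hN, hf, hne⟩ (Submodule.finrank_mono h)
    exact (Submodule.eq_of_le_of_finrank_le h h1).ge

/-- The dual algebra of an infinite dimensional chain coalgebra is a complete skew discrete
valuation ring, whose residue division algebra is finite dimensional. -/
theorem IsChainCoalgebra.exists_uniformizer (hC : IsChainCoalgebra k C)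
    (hinf : ¬ FiniteDimensional k C) :
    ∃ (D : Type u) (_ : DivisionRing D) (_ : Algebra k D) (_ : FiniteDimensional k D)
      (q : ConvDual k C →ₐ[k] D) (x : ConvDual k C), SkewUniformizer k q x ∧
      ∀ a, q a = 0 → ∀ c, ∃ n, (hitR a ^ n) c = 0 := by
  have hnt : Nontrivial C := by
    by_contra h
    rw [not_nontrivial_iff_subsingleton] at h
    exact hinf inferInstance
  have hnz := hC.noZeroDivisors hinf
  obtain ⟨S, hS, hSf, hS0, hmin⟩ := hC.exists_socle
  -- The annihilator of the socle. It is a left ideal because `hitR` preserves `S`, and a right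
  -- ideal because `S` is a right coideal.
  let J : Ideal (ConvDual k C) :=
    { carrier := {a | ∀ c ∈ S, a.ofConv c = 0}
      add_mem' := fun {a b} ha hb c hc => by simp [ha c hc, hb c hc]
      zero_mem' := fun c _ => rfl
      smul_mem' := fun a b hb c hc => by
        rw [smul_eq_mul, mul_apply_hitR]
        exact hb _ (hC.map_hitR_le hS a ⟨c, hc, rfl⟩) }
  have hJ : ∀ a, a ∈ J ↔ ∀ c ∈ S, a.ofConv c = 0 := fun a => Iff.rfl
  have hJ2 : J.IsTwoSided := ⟨fun {a} b ha c hc => by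
    rw [mul_apply_hitL]
    exact ha _ (isRightCoideal_iff.1 hS b c hc)⟩
  have h1J : (1 : ConvDual k C) ∉ J := fun h => by
    apply hS0
    rw [eq_bot_iff]
    intro c hc
    rw [Submodule.mem_bot]
    refine eq_of_convDual (k := k) fun f => ?_
    rw [← counit_hitL, h _ (isRightCoideal_iff.1 hS f c hc), map_zero]
  -- A nonzero kernel would contain the socle `S`, forcing `a` to vanish on `S`.
  have hker : ∀ a, a ∉ J → ∀ c, hitR a c = 0 → c = 0 := by
    intro a ha c hc
    by_contra hne
    apply ha
    have hle := hmin _ (isRightCoideal_ker_hitR a) fun h =>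
      hne ((Submodule.mem_bot k).1 (h ▸ LinearMap.mem_ker.2 hc))
    exact fun d hd => ofConv_eq_zero_of_hitR (hle hd)
  have hne : ∀ a, a ∉ J → a ≠ 0 := fun a ha h => ha (h ▸ J.zero_mem)
  -- Factorization gives a right inverse, which is two-sided because `C^*` is a domain.
  have hunit : ∀ a, a ∉ J → IsUnit a := by
    intro a ha
    obtain ⟨b, hb⟩ := exists_eq_mul (b := 1) (hC.surjective_hitR hinf (hne a ha))
      fun c hc => by rw [hker a ha c hc, map_zero]
    refine ⟨⟨a, b, hb.symm, ?_⟩, rfl⟩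
    have : a * (b * a) = a * 1 := by rw [← mul_assoc, ← hb, one_mul, mul_one]
    exact mul_left_cancel₀ (hne a ha) this
  have hnilp : ∀ a ∈ J, ∀ c, ∃ n, (hitR a ^ n) c = 0 := by
    intro a ha c
    have hstab : ∀ N : Submodule k C, FiniteDimensional k N → IsRightCoideal k N →
        ∃ n, ∀ c ∈ N, (hitR a ^ n) c = 0 := by
      intro N hf
      induction hn : Module.finrank k N using Nat.strong_induction_on generalizing N with
      | _ m ih =>
      intro hN
      by_cases hN0 : N = ⊥
      · exact ⟨0, fun c hc => by simpa [hN0] using hc⟩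
      have hle := hC.map_hitR_le hN a
      -- If `hitR a` mapped `N` onto itself it would be injective on `N`; but it kills `S ≤ N`.
      have hlt : N.map (hitR a) < N := by
        refine lt_of_le_of_ne hle fun heq => ?_
        have hinj : Function.Injective ((hitR a).restrict fun c hc => hle ⟨c, hc, rfl⟩ :
            N →ₗ[k] N) := by
          rw [LinearMap.injective_iff_surjective]
          rintro ⟨c, hc⟩
          rw [← heq] at hc
          obtain ⟨d, hd, rfl⟩ := hc
          exact ⟨⟨d, hd⟩, rfl⟩
        apply h1J
        intro c hc
        have hcN : c ∈ N := hmin N hN hN0 hc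
        have : hitR a c = 0 := eq_of_convDual (k := k) fun f => by
          rw [← mul_apply_hitR, J.mul_mem_right f ha c hc, map_zero]
        have : (⟨c, hcN⟩ : N) = 0 := hinj (Subtype.ext (by simpa using this))
        rw [show c = 0 from congrArg Subtype.val this, map_zero]
      obtain ⟨n, hn'⟩ := ih _ (hn ▸ Submodule.finrank_lt_finrank_of_lt hlt) (N.map (hitR a))
        inferInstance rfl (hN.map_hitR a)
      exact ⟨n + 1, fun c hc => by
        rw [pow_succ, Module.End.mul_apply]; exact hn' _ ⟨c, hc, rfl⟩⟩
    obtain ⟨n, hn⟩ := hstab (orbit k c) inferInstance (isRightCoideal_orbit c)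
    exact ⟨n, hn c (self_mem_orbit c)⟩
  -- The uniformizer is a nonzero element of `J` with kernel of least dimension. `J` is nonzero
  -- because `S` is finite dimensional, hence proper in `C`.
  obtain ⟨x, ⟨hxJ, hx0⟩, hxmin⟩ : ∃ x, MinimalFor (fun a => a ∈ J ∧ a ≠ 0)
      (fun a => Module.finrank k (LinearMap.ker (hitR a))) x := by
    apply exists_minimalFor_of_wellFoundedLT
    obtain ⟨c, -, hc⟩ := SetLike.exists_of_lt (lt_top_iff_ne_top.2 fun h : S = ⊤ =>
      hinf (Module.finite_def.2 (h ▸ Module.Finite.iff_fg.1 hSf)))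
    obtain ⟨f, hf, hfS⟩ := Submodule.exists_dual_map_eq_bot_of_notMem hc inferInstance
    refine ⟨WithConv.toConv f, fun d hd => ?_, fun h => hf ?_⟩
    · exact (Submodule.mem_bot k).1 (hfS ▸ Submodule.mem_map_of_mem hd)
    · rw [← WithConv.ofConv_toConv f, h]; rfl
  have hprop : ∀ a : ConvDual k C, a ≠ 0 → FiniteDimensional k (LinearMap.ker (hitR a)) :=
    fun a ha => hC.finiteDimensional (isRightCoideal_ker_hitR a) fun h => ha <| WithConv.ext <|
      LinearMap.ext fun c => ofConv_eq_zero_of_hitR (LinearMap.mem_ker.1 (h ▸ Submodule.mem_top))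
  have hdvd : ∀ a ∈ J, ∃ b, a = x * b := by
    intro a ha
    by_cases ha0 : a = 0
    · exact ⟨0, by rw [ha0, mul_zero]⟩
    have hle : LinearMap.ker (hitR x) ≤ LinearMap.ker (hitR a) := by
      rcases hC _ _ (isRightCoideal_ker_hitR x) (isRightCoideal_ker_hitR a) with h | h
      · exact h
      · have := hprop x hx0
        exact (Submodule.eq_of_le_of_finrank_le h
          (hxmin (j := a) ⟨ha, ha0⟩ (Submodule.finrank_mono h))).ge
    exact exists_eq_mul (hC.surjective_hitR hinf hx0) fun c hc =>
      ofConv_eq_zero_of_hitR (LinearMap.mem_ker.1 (hle hc))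
  -- `xⁿ C^*` is the annihilator of the kernel of `hitR x ^ n`. These kernels exhaust `C`, so
  -- separatedness is immediate and completeness is gluing of functionals.
  have hpow : ∀ n a, (∃ b, a = x ^ n * b) ↔ ∀ c, (hitR x ^ n) c = 0 → a.ofConv c = 0 := by
    intro n a
    constructor
    · rintro ⟨b, rfl⟩ c hc
      rw [mul_apply_hitR, hitR_pow, hc, map_zero]
    · intro h
      exact exists_eq_mul (hC.surjective_hitR hinf (pow_ne_zero n hx0)) fun c hc =>
        h c (by rwa [← hitR_pow])
  have : Nontrivial (ConvDual k C ⧸ J) :=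
    Ideal.Quotient.nontrivial_iff.2 (J.ne_top_iff_one.2 h1J)
  let _ : DivisionRing (ConvDual k C ⧸ J) := DivisionRing.ofIsUnitOrEqZero fun a => by
    obtain ⟨a, rfl⟩ := Ideal.Quotient.mk_surjective a
    by_cases ha : a ∈ J
    · exact Or.inr (Ideal.Quotient.eq_zero_iff_mem.2 ha)
    · exact Or.inl ((hunit a ha).map _)
  -- The quotient is spanned by extensions to `C` of functionals on the finite dimensional `S`.
  have hfin : FiniteDimensional k (ConvDual k C ⧸ J) := by
    obtain ⟨E, hE⟩ := LinearMap.exists_rightInverse_of_surjective (LinearMap.lcomp k k S.subtype)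
      (LinearMap.range_eq_top.2 fun f => LinearMap.exists_extend f)
    refine Module.Finite.of_surjective ((Ideal.Quotient.mkₐ k J).toLinearMap ∘ₗ
      (WithConv.linearEquiv k (C →ₗ[k] k)).symm.toLinearMap ∘ₗ E) fun a => ?_
    obtain ⟨a, rfl⟩ := Ideal.Quotient.mk_surjective a
    refine ⟨a.ofConv ∘ₗ S.subtype, Ideal.Quotient.eq.2 fun c hc => ?_⟩
    have := LinearMap.congr_fun (LinearMap.congr_fun hE (a.ofConv ∘ₗ S.subtype)) ⟨c, hc⟩
    exact sub_eq_zero.2 this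
  -- Being finite dimensional over `k`, the residue algebra has a copy in the universe of `k`.
  have : Small.{u} (ConvDual k C ⧸ J) := Module.Finite.small.{u} k _
  let e : Shrink.{u} (ConvDual k C ⧸ J) ≃ₐ[k] (ConvDual k C ⧸ J) := Shrink.algEquiv k _
  let q : ConvDual k C →ₐ[k] Shrink.{u} (ConvDual k C ⧸ J) :=
    e.symm.toAlgHom.comp (Ideal.Quotient.mkₐ k J)
  have hq : ∀ a, q a = 0 ↔ a ∈ J := fun a => by
    rw [← Ideal.Quotient.eq_zero_iff_mem]
    exact map_eq_zero_iff e.symm e.symm.injective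
  refine ⟨Shrink.{u} (ConvDual k C ⧸ J), inferInstance, inferInstance,
    e.symm.toLinearEquiv.finiteDimensional, q, x, ⟨?_, ?_, ?_, hx0, ?_, ?_⟩,
    fun a ha => hnilp a ((hq a).1 ha)⟩
  · exact e.symm.surjective.comp Ideal.Quotient.mk_surjective
  · intro a
    rw [hq]
    refine ⟨hdvd a, ?_⟩
    rintro ⟨b, rfl⟩
    exact J.mul_mem_right b hxJ
  · exact fun a ha => hunit a fun h => ha ((hq a).2 h)
  · intro a ha
    refine WithConv.ext (LinearMap.ext fun c => ?_)
    obtain ⟨n, hn⟩ := hnilp x hxJ c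
    exact (hpow n a).1 (ha n) c hn
  · intro a ha
    have hmono : Monotone fun n => LinearMap.ker (hitR x ^ n) := monotone_nat_of_le_succ
      fun n c hc => by
        rw [LinearMap.mem_ker] at hc ⊢
        rw [pow_succ', Module.End.mul_apply, hc, map_zero]
    obtain ⟨l, hl⟩ := exists_limit _ hmono (hnilp x hxJ) (fun n => (a n).ofConv) fun n c hc =>
      sub_eq_zero.1 ((hpow n _).1 (ha n) c hc)
    exact ⟨WithConv.toConv l, fun n => (hpow n _).2 fun c hc => sub_eq_zero.2 (hl n c hc)⟩

end ChainTheory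

open TensorProduct (assoc map)

/-! ### Coalgebra maps into a cotensor coalgebra. -/

section CotensorLift

variable {k : Type u} [Field k] {E M : Type w} [AddCommGroup E] [Module k E] [Coalgebra k E]
  [AddCommGroup M] [Module k M]

/-- A coalgebra map `π : C → E` together with a map `g : C → M` to an `E`-bicomodule that is
bicolinear along `π`. -/
structure BicolinearPair (B : Bicomodule k E M) (C : Type v) [AddCommGroup C] [Module k C]
    [Coalgebra k C] where
  π : C →ₗ[k] E
  g : C →ₗ[k] M
  counit_π : ∀ c, Coalgebra.counit (R := k) (π c) = Coalgebra.counit (R := k) c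
  comul_π : ∀ c, Coalgebra.comul (R := k) (π c) = map π π (Coalgebra.comul (R := k) c)
  left_g : ∀ c, B.left (g c) = map π g (Coalgebra.comul (R := k) c)
  right_g : ∀ c, B.right (g c) = map g π (Coalgebra.comul (R := k) c)

variable {B : Bicomodule k E M} {C : Type v} [AddCommGroup C] [Module k C] [Coalgebra k C]

section Aux

variable {X Y Z Q : Type*} [AddCommGroup X] [Module k X] [AddCommGroup Y] [Module k Y]
  [AddCommGroup Z] [Module k Z] [AddCommGroup Q] [Module k Q]

theorem assoc_rTensor_map {r : X →ₗ[k] Y ⊗[k] Z} {a : C →ₗ[k] X} {b : C →ₗ[k] Y}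
    {c : C →ₗ[k] Z} (h : ∀ x, r (a x) = map b c (Coalgebra.comul (R := k) x)) (f : C →ₗ[k] Q)
    (w : C ⊗[k] C) :
    assoc k Y Z Q (r.rTensor Q (map a f w)) =
      map b (map c f) (assoc k C C C ((Coalgebra.comul (R := k) (A := C)).rTensor C w)) := by
  rw [TensorProduct.map_map_assoc]
  congr 1
  induction w with
  | zero => simp
  | add x y hx hy => simp only [map_add, hx, hy]
  | tmul x y => simp [h]

theorem lTensor_map_comul {S : X →ₗ[k] Y} {f : C →ₗ[k] X} {r : C ⊗[k] C →ₗ[k] Y}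
    (h : ∀ x, S (f x) = r (Coalgebra.comul (R := k) x)) (p : C →ₗ[k] Q) (w : C ⊗[k] C) :
    S.lTensor Q (map p f w) = map p r ((Coalgebra.comul (R := k) (A := C)).lTensor C w) := by
  induction w with
  | zero => simp
  | add x y hx hy => simp only [map_add, hx, hy]
  | tmul x y => simp [h]

theorem rTensor_map_comul {S : X →ₗ[k] Y} {f : C →ₗ[k] X} {r : C ⊗[k] C →ₗ[k] Y}
    (h : ∀ x, S (f x) = r (Coalgebra.comul (R := k) x)) (p : C →ₗ[k] Q) (w : C ⊗[k] C) :
    S.rTensor Q (map f p w) = map r p ((Coalgebra.comul (R := k) (A := C)).rTensor C w) := by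
  induction w with
  | zero => simp
  | add x y hx hy => simp only [map_add, hx, hy]
  | tmul x y => simp [h]

end Aux

namespace BicolinearPair

variable (P : BicolinearPair B C)

/-- The component `C → M^{□ n}` of the coalgebra map to the cotensor coalgebra: `π` for `n = 0`,
and `c ↦ g(c₁) □ ⋯ □ g(cₙ)` for `n > 0`. -/
noncomputable def power : (n : ℕ) →
    {f : C →ₗ[k] (B.power n).carrier // ∀ c, (B.power n).coact (f c) =
      map P.π f (Coalgebra.comul (R := k) c)}
  | 0 => ⟨P.π, P.comul_π⟩
  | 1 => ⟨P.g, P.left_g⟩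
  | n + 2 =>
    let f := power (n + 1)
    ⟨LinearMap.codRestrict (ChainCoalgebra.cotensor B.right (B.power (n + 1)).coact)
      (map P.g f.1 ∘ₗ Coalgebra.comul) (fun c => by
        show assoc k M E _ (B.right.rTensor _ (map P.g f.1 (Coalgebra.comul c))) =
          (B.power (n + 1)).coact.lTensor M (map P.g f.1 (Coalgebra.comul c))
        rw [assoc_rTensor_map P.right_g, lTensor_map_comul f.2, Coalgebra.coassoc_apply]),
      fun c => by
        apply lTensor_inj (Q := E) (Submodule.subtype_injective
          (ChainCoalgebra.cotensor B.right (B.power (n + 1)).coact))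
        refine (subtype_cotensorCoact B (B.power (n + 1)).coact _).trans ?_
        refine (assoc_rTensor_map P.left_g f.1 (Coalgebra.comul c)).trans ?_
        rw [Coalgebra.coassoc_apply]
        exact (lTensor_map_comul (S := (ChainCoalgebra.cotensor B.right
          (B.power (n + 1)).coact).subtype) (fun _ => rfl) P.π (Coalgebra.comul c)).symm⟩

/-- Compatibility with each component of the comultiplication. By induction on `i`, both sides are
iterated coproducts followed by copies of `g` (or `π`), and coassociativity identifies them. -/
theorem split_power (i j : ℕ) (c : C) :
    (B.split i j).1 ((P.power (j + i)).1 c) =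
      map (P.power i).1 (P.power j).1 (Coalgebra.comul (R := k) c) := by
  induction i generalizing c with
  | zero => exact (P.power j).2 c
  | succ i ih =>
    cases i with
    | zero =>
      cases j with
      | zero => exact P.right_g c
      | succ j => rfl
    | succ i =>
      apply rTensor_inj (Q := (B.power j).carrier)
        (Submodule.subtype_injective (ChainCoalgebra.cotensor B.right (B.power (i + 1)).coact))
      refine (subtype_cotensorMap B.right (B.power (j + (i + 1))).coact (B.power (i + 1)).coact
        (B.split (i + 1) j).1 (B.split (i + 1) j).2 _).trans ?_
      rw [LinearEquiv.symm_apply_eq]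
      refine (lTensor_map_comul ih P.g (Coalgebra.comul c)).trans ?_
      rw [← Coalgebra.coassoc_apply, TensorProduct.map_map_assoc]
      refine congrArg _ ?_
      exact (rTensor_map_comul (S := (ChainCoalgebra.cotensor B.right
        (B.power (i + 1)).coact).subtype) (fun _ => rfl) (P.power j).1 (Coalgebra.comul c)).symm

theorem part_power (i j n : ℕ) (h : i + j = n) (c : C) :
    B.part i j n ((P.power n).1 c) =
      map (P.power i).1 (P.power j).1 (Coalgebra.comul (R := k) c) := by
  obtain rfl : j + i = n := by omega
  rw [B.part_self, split_power]

/-- The components define a map to the product of the cotensor powers; local finiteness puts its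
image in the direct sum. -/
theorem exists_lift (hfin : ∀ c, ∃ N, ∀ n, N ≤ n → (P.power n).1 c = 0) :
    ∃ F : C →ₗ[k] CotensorCoalgebra B, (∀ c, F c = 0 → ∀ n, (P.power n).1 c = 0) ∧ ∀ c N, (∀ n, N ≤ n → (P.power n).1 c = 0) →
      F c = ∑ n ∈ Finset.range N, CotensorCoalgebra.ι B n ((P.power n).1 c) := by
  let coe : CotensorCoalgebra B →ₗ[k] ∀ n, (B.power n).carrier :=
    { toFun := fun x n => DirectSum.component k ℕ (fun m => (B.power m).carrier) n x
      map_add' := fun x y => funext fun n => map_add _ _ _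
      map_smul' := fun r x => funext fun n => map_smul _ _ _ }
  have hcoe : Function.Injective coe := fun x y h =>
    DFinsupp.ext fun n => congrFun h n
  let G : C →ₗ[k] ∀ n, (B.power n).carrier := LinearMap.pi fun n => (P.power n).1
  have hG : ∀ c N, (∀ n, N ≤ n → (P.power n).1 c = 0) →
      coe (∑ n ∈ Finset.range N, CotensorCoalgebra.ι B n ((P.power n).1 c)) = G c := by
    intro c N hN
    funext m
    have h1 : ∀ n (y : (B.power n).carrier), coe (CotensorCoalgebra.ι B n y) n = y :=
      fun n y => DirectSum.component.lof_self k (M := fun m => (B.power m).carrier) n y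
    have h2 : ∀ n (y : (B.power n).carrier), n ≠ m → coe (CotensorCoalgebra.ι B n y) m = 0 :=
      fun n y hn => (DirectSum.component.of k (M := fun m => (B.power m).carrier) m n y).trans
        (dif_neg hn)
    rw [map_sum, Finset.sum_apply]
    by_cases hm : m < N
    · rw [Finset.sum_eq_single m (fun n _ hn => h2 n _ hn)
        (fun h => absurd (Finset.mem_range.2 hm) h), h1]
      rfl
    · rw [Finset.sum_eq_zero fun n hn => h2 n _ fun h => hm (h ▸ Finset.mem_range.1 hn)]
      exact (hN m (not_lt.1 hm)).symm
  have hrange : ∀ c, G c ∈ LinearMap.range coe := fun c => by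
    obtain ⟨N, hN⟩ := hfin c
    exact ⟨_, hG c N hN⟩
  let F := LinearMap.codRestrictOfInjective G coe hcoe hrange
  have hF : ∀ c, coe (F c) = G c :=
    LinearMap.codRestrictOfInjective_comp_apply G coe hcoe hrange
  refine ⟨F, fun c hc n => ?_, fun c N hN => hcoe ((hF c).trans (hG c N hN).symm)⟩
  have := hF c
  rw [hc, map_zero] at this
  exact (congrFun this n).symm

/-- The coalgebra map `C → T_E(M)` induced by a locally finite bicolinear pair. -/
theorem exists_coalgHom (hfin : ∀ c, ∃ N, ∀ n, N ≤ n → (P.power n).1 c = 0) :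
    ∃ F : C →ₗc[k] CotensorCoalgebra B, (∀ c, F c = 0 → ∀ n, (P.power n).1 c = 0) ∧ ∀ c N, (∀ n, N ≤ n → (P.power n).1 c = 0) →
      F c = ∑ n ∈ Finset.range N, CotensorCoalgebra.ι B n ((P.power n).1 c) := by
  obtain ⟨F, hF0, hF⟩ := P.exists_lift hfin
  refine ⟨{ F with counit_comp := ?_, map_comp_comul := ?_ }, hF0, hF⟩
  · refine LinearMap.ext fun c => ?_
    obtain ⟨N, hN⟩ := hfin c
    -- The bound `N + 1` ensures that the degree `0` term, the only one seen by the counit, is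
    -- present to be split off.
    rw [LinearMap.comp_apply, hF c (N + 1) (fun n hn => hN n (by omega)),
      Finset.sum_range_succ', map_add, map_sum, Finset.sum_eq_zero, zero_add]
    · exact (CotensorCoalgebra.counit_ι_zero B _).trans (P.counit_π c)
    · exact fun n _ => CotensorCoalgebra.counit_ι_of_ne B (n + 1) n.succ_ne_zero _
  · refine LinearMap.ext fun c => ?_
    have hbound : ∀ w : C ⊗[k] C, ∃ N, ∀ N', N ≤ N' → map F F w =
        ∑ p ∈ Finset.range N' ×ˢ Finset.range N', map (CotensorCoalgebra.ι B p.1)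
          (CotensorCoalgebra.ι B p.2) (map (P.power p.1).1 (P.power p.2).1 w) := by
      intro w
      induction w with
      | zero => exact ⟨0, fun N' _ => by simp⟩
      | add x y hx hy =>
        obtain ⟨N₁, h₁⟩ := hx
        obtain ⟨N₂, h₂⟩ := hy
        refine ⟨max N₁ N₂, fun N' hN' => ?_⟩
        simp only [map_add, Finset.sum_add_distrib]
        rw [h₁ N' (le_trans (le_max_left _ _) hN'), h₂ N' (le_trans (le_max_right _ _) hN')]
      | tmul x y =>
        obtain ⟨N₁, h₁⟩ := hfin x
        obtain ⟨N₂, h₂⟩ := hfin y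
        refine ⟨max N₁ N₂, fun N' hN' => ?_⟩
        rw [TensorProduct.map_tmul, hF x N' fun n hn => h₁ n (by omega),
          hF y N' fun n hn => h₂ n (by omega), TensorProduct.sum_tmul, Finset.sum_product]
        simp only [TensorProduct.tmul_sum, TensorProduct.map_tmul]
    obtain ⟨N₁, h₁⟩ := hbound (Coalgebra.comul c)
    obtain ⟨N₂, h₂⟩ := hfin c
    let N := max N₁ N₂
    have hN : ∀ n, N ≤ n → (P.power n).1 c = 0 := fun n hn =>
      h₂ n (le_trans (le_max_right _ _) hn)
    show map F F (Coalgebra.comul c) = Coalgebra.comul (F c)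
    rw [h₁ N (le_max_left _ _), hF c N hN, map_sum]
    simp only [CotensorCoalgebra.comul_ι]
    -- The square sum is cut to the triangle `p.1 + p.2 < N` and regrouped by antidiagonals. Terms
    -- outside factor through the component of `c` in degree `p.1 + p.2 ≥ N`, which vanishes.
    rw [← Finset.sum_filter_of_ne (p := fun p : ℕ × ℕ => p.1 + p.2 < N),
      ← Finset.sum_fiberwise_of_maps_to (t := Finset.range N) (g := fun p : ℕ × ℕ => p.1 + p.2)]
    · refine Finset.sum_congr rfl fun n hn => ?_
      have hs : Finset.filter (fun p : ℕ × ℕ => p.1 + p.2 = n) (Finset.filter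
          (fun p : ℕ × ℕ => p.1 + p.2 < N) (Finset.range N ×ˢ Finset.range N)) =
          Finset.HasAntidiagonal.antidiagonal n := by
        ext p
        rw [Finset.mem_range] at hn
        simp only [Finset.mem_filter, Finset.mem_product, Finset.mem_range,
          Finset.HasAntidiagonal.mem_antidiagonal]
        omega
      rw [hs]
      refine Finset.sum_congr rfl fun p hp => ?_
      rw [P.part_power p.1 p.2 n (Finset.HasAntidiagonal.mem_antidiagonal.1 hp)]
    · intro p hp
      exact Finset.mem_range.2 (Finset.mem_filter.1 hp).2
    · intro p _ hne
      by_contra hlt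
      apply hne
      rw [← P.part_power p.1 p.2 _ rfl, hN _ (not_lt.1 hlt), map_zero, map_zero]

end BicolinearPair

end CotensorLift

/-! ### Translating comodule identities into identities in `C^*`. -/

section DualMaps

variable {k : Type u} [Field k] {C : Type v} [AddCommGroup C] [Module k C] [Coalgebra k C]

/-- Pairing both sides with `x ⊗ y` turns an equation of coactions into one of convolution products,
so that bicolinearity can be checked by algebra in `C^*`. -/
theorem dualSplit_apply_eq_map {X Y Z : Type w} [AddCommGroup X] [Module k X] [AddCommGroup Y]
    [Module k Y] [AddCommGroup Z] [Module k Z] [FiniteDimensional k X] [FiniteDimensional k Y]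
    (μ : X ⊗[k] Y →ₗ[k] Z) (p : C →ₗ[k] Module.Dual k Z) (q : C →ₗ[k] Module.Dual k X)
    (r : C →ₗ[k] Module.Dual k Y)
    (h : ∀ x y c, p c (μ (x ⊗ₜ y)) =
      (WithConv.toConv (q.flip x) * WithConv.toConv (r.flip y) : ConvDual k C).ofConv c) (c : C) :
    dualSplit μ (p c) = map q r (Coalgebra.comul (R := k) c) := by
  apply (TensorProduct.dualDistribEquiv k X Y).injective
  refine TensorProduct.ext' fun x y => ?_
  rw [dualDistribEquiv_dualSplit, h, LinearMap.convMul_apply]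
  generalize Coalgebra.comul (R := k) c = w
  induction w with
  | zero => simp
  | add a b ha hb => simp only [map_add, LinearMap.add_apply, ha, hb]
  | tmul a b => simp only [TensorProduct.map_tmul, dualDistribEquiv_tmul]; simp

end DualMaps

/-! ### Cotensor powers of `D_α^*` and recognition of `DC(D, α)`. -/

section Twisted

theorem injective_comp_subtype {k V W : Type*} [Field k] [AddCommGroup V] [Module k V]
    [AddCommGroup W] [Module k W] (p : Submodule k V) (f : V →ₗ[k] W)
    (h : ∀ t ∈ p, f t = 0 → t = 0) : Function.Injective (f ∘ₗ p.subtype) :=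
  (injective_iff_map_eq_zero _).2 fun t ht => Subtype.ext (h t.1 t.2 ht)

variable {k : Type u} [Field k] {D : Type u} [DivisionRing D] [Algebra k D]
  [FiniteDimensional k D] (α : D ≃ₐ[k] D)

/-- The identity `D → D_α` as a linear equivalence. -/
def TwistedBimodule.ofEquiv : D ≃ₗ[k] TwistedBimodule α := LinearEquiv.refl k D

/-- Contraction `D_α^* ⊗ N → N` with the element `1` of `D_α`. -/
noncomputable def contractOne (N : Type u) [AddCommGroup N] [Module k N] :
    Module.Dual k (TwistedBimodule α) ⊗[k] N →ₗ[k] N :=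
  (TensorProduct.lid k N).toLinearMap ∘ₗ
    (Module.Dual.eval k (TwistedBimodule α) (TwistedBimodule.of α 1)).rTensor N

omit [FiniteDimensional k D] in
theorem contractOne_tmul {N : Type u} [AddCommGroup N] [Module k N]
    (m : Module.Dual k (TwistedBimodule α)) (n : N) :
    contractOne α N (m ⊗ₜ n) = m (TwistedBimodule.of α 1) • n := by
  simp [contractOne]

/-- Contraction with `1` is injective on `D_α^* □ N`. -/
theorem eq_zero_of_contractOne {N : Type u} [AddCommGroup N] [Module k N]
    (l : N →ₗ[k] Module.Dual k D ⊗[k] N)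
    {t : Module.Dual k (TwistedBimodule α) ⊗[k] N}
    (ht : t ∈ cotensor (dualBicomodule k D (TwistedBimodule α)).right l)
    (h : contractOne α N t = 0) : t = 0 := by
  refine eq_zero_of_rTensor_dual t fun f => ?_
  obtain ⟨y, rfl⟩ := (Module.evalEquiv k (TwistedBimodule α)).surjective f
  -- Every element of `D_α` is `1 ◁ b = α(b)`. Contraction with it is the right coaction evaluated
  -- at `(1, b)`, and the cotensor condition moves `b` to the coaction on `N`, applied after
  -- contracting with `1`.
  obtain ⟨b, rfl⟩ : ∃ b, TwistedBimodule.of α (α b) = y := ⟨α.symm y, α.apply_symm_apply y⟩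
  let ψ : Module.Dual k D ⊗[k] N →ₗ[k] N :=
    (TensorProduct.lid k N).toLinearMap ∘ₗ (Module.Dual.eval k D b).rTensor N
  have h1 : ∀ t, TensorProduct.lid k N ((Module.evalEquiv k (TwistedBimodule α)
      (TwistedBimodule.of α (α b)) : Module.Dual k (Module.Dual k (TwistedBimodule α))).rTensor N t)
      = contractOne α N (ψ.lTensor _ (assoc k _ _ N
        ((dualBicomodule k D (TwistedBimodule α)).right.rTensor N t))) := by
    intro t
    induction t with
    | zero => simp
    | add x y hx hy => simp only [map_add, hx, hy]
    | tmul m n =>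
      have h2 : ∀ w : Module.Dual k (TwistedBimodule α) ⊗[k] Module.Dual k D,
          contractOne α N (ψ.lTensor _ (assoc k _ _ N (w ⊗ₜ n))) =
          TensorProduct.dualDistribEquiv k _ _ w (TwistedBimodule.of α 1 ⊗ₜ b) • n := by
        intro w
        induction w with
        | zero => simp
        | add x y hx hy =>
          simp only [map_add, TensorProduct.add_tmul, hx, hy, LinearMap.add_apply, add_smul]
        | tmul x y =>
          simp [ψ, contractOne_tmul, smul_smul, mul_comm]
      rw [LinearMap.rTensor_tmul, LinearMap.rTensor_tmul, h2]
      have h3 : TensorProduct.dualDistribEquiv k _ _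
          ((dualBicomodule k D (TwistedBimodule α)).right m) (TwistedBimodule.of α 1 ⊗ₜ b) =
          m (TwistedBimodule.of α (α b)) := by
        refine (dualDistribEquiv_dualSplit _ m _).trans ?_
        rw [rightAction_tmul, TwistedBimodule.op_smul_of, one_mul]
      rw [h3]
      simp
  have h4 : ∀ t, contractOne α N (ψ.lTensor _ (l.lTensor _ t)) = ψ (l (contractOne α N t)) := by
    intro t
    induction t with
    | zero => simp
    | add x y hx hy => simp only [map_add, hx, hy]
    | tmul m n => simp [contractOne_tmul]
  have ht' : assoc k _ _ N ((dualBicomodule k D (TwistedBimodule α)).right.rTensor N t) =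
    l.lTensor _ t := ht
  rw [h1, ht', h4]
  exact (congrArg (fun z => ψ (l z)) h).trans (by simp)

theorem contractOne_injective {N : Type u} [AddCommGroup N] [Module k N]
    (l : N →ₗ[k] Module.Dual k D ⊗[k] N) :
    Function.Injective (contractOne α N ∘ₗ
      (cotensor (dualBicomodule k D (TwistedBimodule α)).right l).subtype) :=
  injective_comp_subtype (cotensor (dualBicomodule k D (TwistedBimodule α)).right l)
    (contractOne α N) fun _ ht h => eq_zero_of_contractOne α l ht h

/-- The embedding `(D_α^*)^{□ n} → D^*` obtained by contracting with `1` repeatedly. -/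
noncomputable def contract : (n : ℕ) →
    {f : ((dualBicomodule k D (TwistedBimodule α)).power n).carrier →ₗ[k] Module.Dual k D //
      Function.Injective f}
  | 0 => ⟨LinearMap.id, Function.injective_id⟩
  -- Precomposition with `α` makes degree `1` fit `contract_power`: `s(α d) x = x s(d)`.
  | 1 => ⟨((TwistedBimodule.ofEquiv α).toLinearMap ∘ₗ α.toLinearMap).dualMap,
      LinearMap.dualMap_injective_of_surjective
        ((TwistedBimodule.ofEquiv α).surjective.comp α.surjective)⟩
  | n + 2 =>
    let f := contract (n + 1)
    ⟨f.1 ∘ₗ contractOne α _ ∘ₗ (cotensor (dualBicomodule k D (TwistedBimodule α)).right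
      ((dualBicomodule k D (TwistedBimodule α)).power (n + 1)).coact).subtype, by
      exact f.2.comp (contractOne_injective α _)⟩

variable {α} {C : Type v} [AddCommGroup C] [Module k C] [Coalgebra k C]

/-- The bicolinear pair dual to an algebra map `s : D → C^*` and an element `x` of `C^*` with
`x s(d) = s(α d) x`. -/
noncomputable def dualPair (s : D →ₐ[k] ConvDual k C) (x : ConvDual k C)
    (hx : ∀ d, x * s d = s (α d) * x) :
    BicolinearPair (dualBicomodule k D (TwistedBimodule α)) C where
  π := ((WithConv.linearEquiv k (C →ₗ[k] k)).toLinearMap ∘ₗ s.toLinearMap).flip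
  g := ((WithConv.linearEquiv k (C →ₗ[k] k)).toLinearMap ∘ₗ LinearMap.mulRight k x ∘ₗ
    s.toLinearMap ∘ₗ (TwistedBimodule.ofEquiv α).symm.toLinearMap).flip
  counit_π c := by
    show (s 1).ofConv c = _
    rw [map_one, LinearMap.convOne_apply]
    rfl
  comul_π := dualSplit_apply_eq_map _ _ _ _ fun a b c => by
    show (s (LinearMap.mul' k D (a ⊗ₜ b))).ofConv c = (s a * s b).ofConv c
    rw [LinearMap.mul'_apply, map_mul]
  left_g := dualSplit_apply_eq_map _ _ _ _ fun (a : D) (b : D) c => by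
    show (s (a * b) * x).ofConv c = (s a * (s b * x)).ofConv c
    rw [map_mul, mul_assoc]
  -- The only field that needs the commutation rule `hx`.
  right_g := dualSplit_apply_eq_map _ _ _ _ fun (a : D) (b : D) c => by
    show (s (a * α b) * x).ofConv c = (s a * x * s b).ofConv c
    rw [map_mul, mul_assoc, mul_assoc, hx]

/-- Contracting `g(c₁)` with `1` leaves `x(c₁)`, so each contraction amounts to one application of
`hitR x`. The lift is thereby determined by `π` and powers of `hitR x`. -/
theorem contract_power (s : D →ₐ[k] ConvDual k C) (x : ConvDual k C)
    (hx : ∀ d, x * s d = s (α d) * x) (n : ℕ) (c : C) :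
    (contract α n).1 (((dualPair s x hx).power n).1 c) =
      (dualPair s x hx).π ((hitR x ^ n) c) := by
  induction n generalizing c with
  | zero => rfl
  | succ n ih =>
    cases n with
    | zero =>
      refine LinearMap.ext fun d => ?_
      show (s (α d) * x).ofConv c = (s d).ofConv ((hitR x ^ 1) c)
      rw [← hx, mul_apply_hitR, pow_one]
    | succ n =>
      rw [pow_succ, Module.End.mul_apply, ← ih]
      refine congrArg (contract α (n + 1)).1 ?_
      show contractOne α _ (map (dualPair s x hx).g ((dualPair s x hx).power (n + 1)).1
        (Coalgebra.comul c)) = _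
      rw [hitR_apply]
      generalize Coalgebra.comul (R := k) c = w
      induction w with
      | zero => simp
      | add a b ha hb => simp only [map_add, ha, hb]
      | tmul a b =>
        rw [TensorProduct.map_tmul, contractOne_tmul, LinearMap.rTensor_tmul,
          TensorProduct.lid_tmul, map_smul]
        congr 1
        show (s 1 * x).ofConv a = _
        rw [map_one, one_mul]

/-- Recognition of `DC(D, α)`: if `C^*` is generated by a copy of `D` and a topologically nilpotent
element `x` with `x s(d) = s(α d) x`, acting surjectively on `C`, then `C ≅ DC(D, α)`. -/
theorem nonempty_coalgEquiv_DC (s : D →ₐ[k] ConvDual k C) (x : ConvDual k C)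
    (hx : ∀ d, x * s d = s (α d) * x) (hsurj : Function.Surjective (hitR x))
    (hnil : ∀ c, ∃ n, (hitR x ^ n) c = 0) (hdecomp : ∀ a, ∃ d b, a = s d + x * b)
    (hdisj : ∀ d b, s d = x * b → d = 0) : Nonempty (C ≃ₗc[k] DC α) := by
  let P := dualPair s x hx
  have hP : ∀ n c, (contract α n).1 ((P.power n).1 c) = P.π ((hitR x ^ n) c) :=
    contract_power s x hx
  have hzero : ∀ c N, (hitR x ^ N) c = 0 → ∀ n, N ≤ n → (P.power n).1 c = 0 := by
    intro c N hN n hn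
    apply (contract α n).2
    obtain ⟨i, rfl⟩ := Nat.exists_eq_add_of_le' hn
    rw [hP, pow_add, Module.End.mul_apply, hN]
    simp
  -- On the kernel of `hitR x` the part `x * b` of a functional vanishes, so only the values of
  -- `s(D)`, recorded by `π`, remain.
  have hker : ∀ c, hitR x c = 0 → P.π c = 0 → c = 0 := by
    intro c hc hπ
    refine eq_of_convDual (k := k) fun a => ?_
    obtain ⟨d, b, rfl⟩ := hdecomp a
    rw [map_zero, WithConv.ofConv_add, LinearMap.add_apply, mul_apply_hitR, hc, map_zero, add_zero]
    exact LinearMap.congr_fun hπ d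
  -- Otherwise evaluation at some `d ≠ 0` kills the image of the kernel. Then `s d` vanishes on the
  -- kernel of `hitR x`, so it lies in `x C^*`, contradicting `hdisj`.
  have hsoc : ∀ φ : Module.Dual k D, ∃ c, hitR x c = 0 ∧ P.π c = φ := by
    intro φ
    by_contra hφ
    have hφ' : φ ∉ (LinearMap.ker (hitR x)).map P.π := by
      rintro ⟨c, hc, rfl⟩
      exact hφ ⟨c, hc, rfl⟩
    obtain ⟨f, hf, hfW⟩ := Submodule.exists_dual_map_eq_bot_of_notMem hφ' inferInstance
    obtain ⟨d, rfl⟩ := (Module.evalEquiv k D).surjective f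
    apply hf
    obtain ⟨b, hb⟩ := exists_eq_mul (b := s d) hsurj fun c hc =>
      (Submodule.mem_bot k).1 (hfW ▸ Submodule.mem_map_of_mem (Submodule.mem_map_of_mem
        (LinearMap.mem_ker.2 hc)))
    rw [hdisj d b hb]
    simp
  have hpow : ∀ n : ℕ, Function.Surjective ⇑(hitR x ^ n) := by
    intro n
    induction n with
    | zero => exact fun c => ⟨c, rfl⟩
    | succ n ih => rw [pow_succ]; exact ih.comp hsurj
  obtain ⟨F, hF0, hF⟩ := P.exists_coalgHom fun c =>
    (hnil c).imp fun N hN => hzero c N hN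
  refine ⟨CoalgEquiv.ofBijective (f := F) ⟨(injective_iff_map_eq_zero F).2 fun c hc => ?_, ?_⟩⟩
  -- Replacing `c` by `hitR x c` shifts the components, so induction on the nilpotency index
  -- applies, with `hker` closing each step.
  · have h1 : ∀ n, P.π ((hitR x ^ n) c) = 0 := fun n => by rw [← hP, hF0 c hc, map_zero]
    obtain ⟨n, hn⟩ := hnil c
    clear hc
    induction n generalizing c with
    | zero => exact hn
    | succ n ih =>
      refine hker c (ih _ (fun m => ?_) ?_) (h1 0)
      · rw [← Module.End.mul_apply, ← pow_succ]; exact h1 _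
      · rw [← Module.End.mul_apply, ← pow_succ]; exact hn
  · have hι : ∀ n t, CotensorCoalgebra.ι (dualBicomodule k D (TwistedBimodule α)) n t ∈
        LinearMap.range F.toLinearMap := by
      intro n
      induction n using Nat.strong_induction_on with
      | _ n ih =>
      intro t
      -- Lift `t` to the kernel of `hitR x`, then pull back along `hitR x ^ n`. The resulting `c`
      -- has degree `n` component `t` and none above, and its lower components are covered by
      -- induction.
      obtain ⟨c₀, hc₀, hc₀'⟩ := hsoc ((contract α n).1 t)
      obtain ⟨c, rfl⟩ := hpow n c₀
      have ht : (P.power n).1 c = t := (contract α n).2 ((hP n c).trans hc₀')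
      have hFc := hF c (n + 1) (hzero c (n + 1) (by rw [pow_succ', Module.End.mul_apply, hc₀]))
      rw [Finset.sum_range_succ, ht] at hFc
      rw [← sub_eq_iff_eq_add'.2 hFc]
      exact Submodule.sub_mem _ ⟨c, rfl⟩
        (Submodule.sum_mem _ fun i hi => ih i (Finset.mem_range.1 hi) _)
    refine (LinearMap.range_eq_top (f := F.toLinearMap)).1 ?_
    rw [← Submodule.ker_mkQ (LinearMap.range F.toLinearMap), LinearMap.ker_eq_top]
    refine CotensorCoalgebra.hom_ext fun n => LinearMap.ext fun t => ?_
    exact (Submodule.Quotient.mk_eq_zero _).2 (hι n t)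

end Twisted

end ChainCoalgebra

theorem mainTheorem7 {k : Type u} [Field k] [PerfectField k] {C : Type v} [AddCommGroup C]
    [Module k C] [Coalgebra k C] (hC : ChainCoalgebra.IsChainCoalgebra k C)
    (hinf : ¬ FiniteDimensional k C) :
    ∃ (D : Type u) (_ : DivisionRing D) (_ : Algebra k D) (_ : FiniteDimensional k D)
      (α : D ≃ₐ[k] D), Nonempty (C ≃ₗc[k] ChainCoalgebra.DC α) := by
  obtain ⟨D, _, _, _, q, x, H, hnil⟩ := hC.exists_uniformizer hinf
  have := hC.noZeroDivisors hinf
  have : Nontrivial (ChainCoalgebra.ConvDual k C) := ⟨x, 0, H.ne_zero⟩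
  obtain ⟨s, hs⟩ := H.exists_section
  obtain ⟨α, u, hu, hα⟩ := H.exists_twist s hs
  have hq : ∀ b, q (x * b) = 0 := fun b => (H.map_eq_zero_iff _).2 ⟨b, rfl⟩
  -- As `u` is a unit, `x * u` generates the same right ideal as `x`, namely the kernel of `q`; this
  -- gives the decomposition `s(D) ⊕ xu C^*`.
  refine ⟨D, _, _, ‹_›, α, ChainCoalgebra.nonempty_coalgEquiv_DC s (x * u) hα
    (hC.surjective_hitR hinf (mul_ne_zero H.ne_zero hu.ne_zero)) (hnil _ (hq u))
    (fun a => ?_) fun d b h => ?_⟩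
  · obtain ⟨b, hb⟩ := (H.map_eq_zero_iff (a - s (q a))).1 (by rw [map_sub, hs, sub_self])
    obtain ⟨u, rfl⟩ := hu
    refine ⟨q a, u⁻¹.1 * b, ?_⟩
    rw [mul_assoc, Units.mul_inv_cancel_left, ← hb, add_sub_cancel]
  · rw [← hs d, h, mul_assoc, hq]
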